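/- Let $A\in\mathbb R^{n\times n}$, $B\in\mathbb R^{n\times p}$, $C_i\in\mathbb R^{m_i\times n}$ ($i\in\mathcal N=\{1,\dots,N\}$), and consider the plant with $N$ attacked sensor banks $$\dot x = Ax+Bu,\qquad y_i = C_i x + a_i,\quad i\in\mathcal N,$$ where the input $u$ and the attack signals $a_i$ are locally integrable functions of time on $[0,\infty)$. Let $q\ge 0$ be an integer, and let $\mathcal U_i=\bigcap_{k\ge 0}\ker(C_iA^k)$ be the unobservable subspace of $(C_i,A)$. Assume: 1. at least $N-q$ of the signals $a_i$ vanish identically on $[0,\infty)$; 2. ($2q$-redundant observability) for every $\mathcal N'\subset\mathcal N$ with $|\mathcal N'|=\max(N-2q,0)$, the pair $(C',A)$ is observable, where $C'$ is the stacked matrix of the $C_i$, $i\in\mathcal N'$; 3. the communication graph on $\mathcal N$ is undirected and connected (with adjacency elements $0$ or $1$), and $\mathcal N_i$ is the set of neighbors of $i$; 4. $\{v_1,\dots,v_n\}$ is a basis of $\mathbb R^n$ such that every $\mathcal U_i$ is the span of a subset of it. Let $w_1,\dots,w_n\in\mathbb R^n$ be such that $[w_1\ \cdots\ w_n]^T[v_1\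 \cdots\ v_n]=I_n$. Let $s_i^l=1$ if $v_l\notin\mathcal U_i$ and $s_i^l=0$ otherwise, let $o_i=n-\dim\mathcal U_i$, let $\mathcal V_i\in\mathbb R^{n\times o_i}$ have the columns $v_l$ with $s_i^l=1$, and let $\mathcal W_i\in\mathbb R^{o_i\times n}$ have the rows $w_l^T$ with $s_i^l=1$. Let $L_i\in\mathbb R^{o_i\times m_i}$ be such that $\mathcal W_iA\mathcal V_i-L_iC_i\mathcal V_i$ is Hurwitz. With gains $\kappa$ and $\gamma$, consider the observers $$\dot z_i=\mathcal W_i(A\mathcal V_iz_i+Bu)+L_i(y_i-C_i\mathcal V_iz_i)\in\mathbb R^{o_i},$$ $$\dot{\hat x}_i=A\hat x_i+Bu+\kappa\sum_{l=1}^n s_i^l\,\mathrm{sgn}(w_l^T\mathcal V_iz_i-w_l^T\hat x_i)\,v_l+\kappa\gamma\sum_{j\in\mathcal N_i}(\hat x_j-\hat x_i)\in\mathbb R^n,\qquad i\in\mathcal N.$$ Then for each compact set $K\subset\mathbb R^{n+\sum_{i=1}^N(o_i+n)}$ and each $\eta>0$ there exist $\kappa^*$ and $\gamma^*$, which do not depend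 on the input, on the attack or on the initial condition in $K$, such that for each $\kappa>\kappa^*$, each $\gamma>\gamma^*$, each such $u$ and $(a_i)_{i\in\mathcal N}$, and each $\mathrm{col}(x(0),z_1(0),\hat x_1(0),\dots,z_N(0),\hat x_N(0))\in K$, the Filippov solution of the plant together with the observers exists for all $t\ge 0$ (there is a solution on $[0,\infty)$, and every solution on an interval $[0,T)$ extends to one on $[0,\infty)$), and every such solution on $[0,\infty)$ satisfies $$\limsup_{t\to\infty}\|\hat x_i(t)-x(t)\|_\infty\le\eta\qquad\text{for all } i\in\mathcal N .$$ -/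

import Mathlib

open Set Filter Topology MeasureTheory
open scoped Matrix

noncomputable section

/-! ### Filippov solutions of differential equations with discontinuous right-hand side -/

/-- The Filippov set-valued regularization
`⋂_{δ > 0} ⋂_{|Z| = 0} closure (conv f(t, B(x, δ) \ Z))` of the vector field `f`. -/
def filippovMap {E : Type*} [NormedAddCommGroup E] [NormedSpace ℝ E] [MeasureSpace E]
    (f : ℝ → E → E) (t : ℝ) (x : E) : Set E :=
  ⋂ (δ : ℝ) (_ : 0 < δ) (Z : Set E) (_ : volume Z = 0),
    closure (convexHull ℝ (f t '' (Metric.ball x δ \ Z)))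

/-- `X` is a Filippov solution of `ẋ = f(t, x)` on the interval `I`: it is absolutely continuous on
every compact subinterval of `I`, and `Ẋ(t)` exists and lies in the Filippov regularization of `f`
at `(t, X(t))` for almost every `t ∈ I`. -/
def IsFilippovSolutionOn {E : Type*} [NormedAddCommGroup E] [NormedSpace ℝ E] [MeasureSpace E]
    (f : ℝ → E → E) (X : ℝ → E) (I : Set ℝ) : Prop :=
  (∀ b ∈ I, ∀ c ∈ I, AbsolutelyContinuousOnInterval X b c) ∧
    ∀ᵐ t ∂(volume.restrict I), ∃ d ∈ filippovMap f t (X t), HasDerivAt X d t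

/-! ### Linear systems -/

/-- The unobservable subspace `⋂ₖ ker (C Aᵏ)` of the pair `(C, A)`
(by Cayley-Hamilton, the exponents `k < n` give the same intersection). -/
def unobservableSubspace {o : Type*} {n : ℕ} (C : Matrix o (Fin n) ℝ)
    (A : Matrix (Fin n) (Fin n) ℝ) : Submodule ℝ (Fin n → ℝ) :=
  ⨅ k : ℕ, LinearMap.ker (Matrix.mulVecLin (C * A ^ k))

/-- The pair `(C, A)` is observable. -/
def IsObservablePair {o : Type*} {n : ℕ} (C : Matrix o (Fin n) ℝ)
    (A : Matrix (Fin n) (Fin n) ℝ) : Prop :=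
  unobservableSubspace C A = ⊥

/-- The stacked matrix of the blocks `C i`, `i ∈ S`. -/
def stackedMatrix {N n : ℕ} {m : Fin N → ℕ} (C : (i : Fin N) → Matrix (Fin (m i)) (Fin n) ℝ)
    (S : Finset (Fin N)) : Matrix (Σ i : S, Fin (m i)) (Fin n) ℝ :=
  Matrix.of fun r j => C r.1 r.2 j

/-- `2q`-redundant observability: the plant is observable from any `N - 2q` sensor banks.
The subtraction is truncated, so for `2q ≥ N` the plant would have to be observable from no
measurement at all. -/
def IsRedundantlyObservable {N n : ℕ} {m : Fin N → ℕ}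
    (C : (i : Fin N) → Matrix (Fin (m i)) (Fin n) ℝ) (A : Matrix (Fin n) (Fin n) ℝ)
    (q : ℕ) : Prop :=
  ∀ S : Finset (Fin N), S.card = N - 2 * q → IsObservablePair (stackedMatrix C S) A

/-- The square matrix `M` is Hurwitz: all of its complex eigenvalues have negative real part. -/
def IsHurwitz {o : Type*} [Fintype o] [DecidableEq o] (M : Matrix o o ℝ) : Prop :=
  ∀ μ ∈ spectrum ℂ (M.map (algebraMap ℝ ℂ)), μ.re < 0

/-! ### The attack -/

/-- At least `N - q` of the attack signals `a i` vanish identically on `[0, ∞)`. -/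
def AttacksAtMost {N : ℕ} {m : Fin N → ℕ} (a : (i : Fin N) → ℝ → Fin (m i) → ℝ) (q : ℕ) : Prop :=
  N - q ≤ {i : Fin N | ∀ t : ℝ, 0 ≤ t → a i t = 0}.ncard

/-! ### The common basis and the matrices built from it -/

/-- Every unobservable subspace of the pairs `(C i, A)` is the span of a subset of the basis `v`. -/
def IsCommonBasis {N n : ℕ} {m : Fin N → ℕ} (C : (i : Fin N) → Matrix (Fin (m i)) (Fin n) ℝ)
    (A : Matrix (Fin n) (Fin n) ℝ) (v : Module.Basis (Fin n) ℝ (Fin n → ℝ)) : Prop :=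
  ∀ i, ∃ S : Set (Fin n), unobservableSubspace (C i) A = Submodule.span ℝ (v '' S)

/-- The vector `w_l` of the dual basis, that is, `[w_1 ⋯ w_n]ᵀ [v_1 ⋯ v_n] = I`. -/
def dualVec {n : ℕ} (v : Module.Basis (Fin n) ℝ (Fin n → ℝ)) (l : Fin n) : Fin n → ℝ :=
  fun j => v.repr (Pi.single j 1) l

theorem dualVec_dotProduct {n : ℕ} (v : Module.Basis (Fin n) ℝ (Fin n → ℝ)) (l : Fin n)
    (x : Fin n → ℝ) : dualVec v l ⬝ᵥ x = v.repr x l := by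
  have h : x = ∑ j, x j • (Pi.single j (1 : ℝ) : Fin n → ℝ) := pi_eq_sum_univ' x
  conv_rhs => rw [h]
  simp [dualVec, dotProduct, mul_comm]

theorem dualVec_dotProduct_basis {n : ℕ} (v : Module.Basis (Fin n) ℝ (Fin n → ℝ)) (l k : Fin n) :
    dualVec v l ⬝ᵥ v k = if l = k then 1 else 0 := by
  rw [dualVec_dotProduct, Module.Basis.repr_self, Finsupp.single_apply]
  simp [eq_comm]

/-- The indices `l` with `v_l ∉ U`, where `U` is the unobservable subspace of `(C, A)`. If `U` is
spanned by a subset of the basis, their number is `n - dim U`. -/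
abbrev ObsIdx {o : Type*} {n : ℕ} (C : Matrix o (Fin n) ℝ) (A : Matrix (Fin n) (Fin n) ℝ)
    (v : Module.Basis (Fin n) ℝ (Fin n → ℝ)) : Type :=
  {l : Fin n // v l ∉ unobservableSubspace C A}

instance {o : Type*} {n : ℕ} (C : Matrix o (Fin n) ℝ) (A : Matrix (Fin n) (Fin n) ℝ)
    (v : Module.Basis (Fin n) ℝ (Fin n → ℝ)) : Fintype (ObsIdx C A v) :=
  Fintype.ofFinite _

open Classical in
/-- The indicator `s_l`, equal to `1` if `v_l ∉ U` and to `0` if `v_l ∈ U`, where `U` is the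
unobservable subspace of `(C, A)`. -/
def obsIndicator {o : Type*} {n : ℕ} (C : Matrix o (Fin n) ℝ) (A : Matrix (Fin n) (Fin n) ℝ)
    (v : Module.Basis (Fin n) ℝ (Fin n → ℝ)) (l : Fin n) : ℝ :=
  if v l ∈ unobservableSubspace C A then 0 else 1

/-- The matrix with columns `v_l`, `v_l ∉ U`. -/
def obsV {o : Type*} {n : ℕ} (C : Matrix o (Fin n) ℝ) (A : Matrix (Fin n) (Fin n) ℝ)
    (v : Module.Basis (Fin n) ℝ (Fin n → ℝ)) : Matrix (Fin n) (ObsIdx C A v) ℝ :=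
  Matrix.of fun j l => v l.1 j

/-- The matrix with rows `w_lᵀ`, `v_l ∉ U`. -/
def obsW {o : Type*} {n : ℕ} (C : Matrix o (Fin n) ℝ) (A : Matrix (Fin n) (Fin n) ℝ)
    (v : Module.Basis (Fin n) ℝ (Fin n → ℝ)) : Matrix (ObsIdx C A v) (Fin n) ℝ :=
  Matrix.of fun l j => dualVec v l.1 j

/-! ### The plant together with its observers -/

/-- The joint state `(x, (z_i)_i, (x̂_i)_i)` of the plant, the partial observers and the
median-based consensus observers. -/
abbrev JointState {N n : ℕ} {m : Fin N → ℕ} (C : (i : Fin N) → Matrix (Fin (m i)) (Fin n) ℝ)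
    (A : Matrix (Fin n) (Fin n) ℝ) (v : Module.Basis (Fin n) ℝ (Fin n → ℝ)) : Type :=
  (Fin n → ℝ) × ((i : Fin N) → ObsIdx (C i) A v → ℝ) × (Fin N → Fin n → ℝ)

/-- Right-hand side of the partial observer
`ż = W (A V z + B u) + L (y - C V z)`. -/
def partialObserverField {o : Type*} [Fintype o] {n p : ℕ} (C : Matrix o (Fin n) ℝ)
    (A : Matrix (Fin n) (Fin n) ℝ) (B : Matrix (Fin n) (Fin p) ℝ)
    (v : Module.Basis (Fin n) ℝ (Fin n → ℝ)) (L : Matrix (ObsIdx C A v) o ℝ)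
    (u : Fin p → ℝ) (y : o → ℝ) (z : ObsIdx C A v → ℝ) : ObsIdx C A v → ℝ :=
  obsW C A v *ᵥ (A *ᵥ (obsV C A v *ᵥ z) + B *ᵥ u) + L *ᵥ (y - C *ᵥ (obsV C A v *ᵥ z))

/-- Right-hand side of the consensus observer of agent `i`:
`A x̂_i + B u + κ ∑_l s_i^l sgn(w_lᵀ V_i z_i - w_lᵀ x̂_i) v_l + κ γ ∑_{j ∈ N_i} (x̂_j - x̂_i)`. -/
def consensusObserverField {N n p : ℕ} {m : Fin N → ℕ}
    (C : (i : Fin N) → Matrix (Fin (m i)) (Fin n) ℝ) (A : Matrix (Fin n) (Fin n) ℝ)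
    (B : Matrix (Fin n) (Fin p) ℝ) (G : SimpleGraph (Fin N)) [DecidableRel G.Adj]
    (v : Module.Basis (Fin n) ℝ (Fin n → ℝ)) (κ γ : ℝ) (u : Fin p → ℝ) (i : Fin N)
    (z : ObsIdx (C i) A v → ℝ) (xh : Fin N → Fin n → ℝ) : Fin n → ℝ :=
  A *ᵥ xh i + B *ᵥ u
    + κ • ∑ l, (obsIndicator (C i) A v l *
        Real.sign (dualVec v l ⬝ᵥ (obsV (C i) A v *ᵥ z) - dualVec v l ⬝ᵥ xh i)) • v l
    + (κ * γ) • ∑ j ∈ G.neighborFinset i, (xh j - xh i)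

/-- Right-hand side of the whole interconnection: the plant `ẋ = A x + B u` with the attacked
outputs `y_i = C_i x + a_i`, the partial observers driven by `(u, y_i)`, and the consensus
observers. -/
def closedLoopField {N n p : ℕ} {m : Fin N → ℕ}
    (C : (i : Fin N) → Matrix (Fin (m i)) (Fin n) ℝ) (A : Matrix (Fin n) (Fin n) ℝ)
    (B : Matrix (Fin n) (Fin p) ℝ) (G : SimpleGraph (Fin N)) [DecidableRel G.Adj]
    (v : Module.Basis (Fin n) ℝ (Fin n → ℝ))
    (L : (i : Fin N) → Matrix (ObsIdx (C i) A v) (Fin (m i)) ℝ) (κ γ : ℝ)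
    (u : ℝ → Fin p → ℝ) (a : (i : Fin N) → ℝ → Fin (m i) → ℝ) (t : ℝ)
    (X : JointState C A v) : JointState C A v :=
  (A *ᵥ X.1 + B *ᵥ u t,
    fun i => partialObserverField (C i) A B v (L i) (u t) (C i *ᵥ X.1 + a i t) (X.2.1 i),
    fun i => consensusObserverField C A B G v κ γ (u t) i (X.2.1 i) X.2.2)

end

/-!
The closed loop is a linear system with the feedback `Ψ (sign (h X))`, where the switching functions
`h`, the arguments of the signs, are linear and independent. Its Filippov regularization therefore
replaces the signs by the set-valued ones (`mem_filippovMap_closedLoopField_iff`). In suitable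
coordinates the feedback is passive (`passiveCoords_dotProduct_signInput`). As the set-valued sign
is monotone, the distance of two solutions in these coordinates satisfies a Grönwall inequality,
which gives uniqueness (`eq_of_passive_signSet`); the same inequality shows that the solutions for
saturated signs converge, and their limit is a solution for all times
(`exists_passive_signSet_solution`).

The error of the partial observer of an unattacked sensor bank obeys a Hurwitz system
(`partialError_closedLoop`), so it tends to zero and is bounded in terms of the initial state alone.
In the coordinates of the basis `v`, the errors `y i l` of the consensus observers obey
`y' = A y + κ s σ + κ γ (coupling)` (`consensusError_closedLoop`), where `σ i l` is a value of the
sign of the error of the partial observer minus `y i l`. The Laplacian coupling makes the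
disagreement of the agents small, because `γ` beats the signs and `A`. The bound on `γ` does not
depend on `κ ≥ 1`, as `κ` multiplies the signs and the coupling alike
(`SimpleGraph.Connected.exists_disagreement_deriv_le`). Redundancy means that each basis vector is
observable from at least `2 q + 1` sensor banks, hence among them the unattacked ones outnumber the
attacked ones (`one_le_sum_obsIndicator`). Where the average over the agents of a component of `y`
exceeds the disagreement plus the errors of the unattacked partial observers, the signs of this
majority push it back with strength at least `κ / N`, which dominates the drift due to `A` as long
as the averages stay in a ball whose radius is fixed in advance by `K`. So they never leave this
ball, and they end up within the tolerance (`SimpleGraph.Connected.exists_gains`).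
-/

noncomputable section

/-! ### Absolutely continuous functions -/

namespace AbsolutelyContinuousOnInterval

theorem lipschitz_comp {X Y : Type*} [PseudoMetricSpace X] [PseudoMetricSpace Y] {f : ℝ → X}
    {g : X → Y} {K : NNReal} {a b : ℝ} (hg : LipschitzWith K g)
    (hf : AbsolutelyContinuousOnInterval f a b) :
    AbsolutelyContinuousOnInterval (fun t => g (f t)) a b := by
  refine squeeze_zero (fun E => Finset.sum_nonneg fun i _ => dist_nonneg) (fun E => ?_)
    (by simpa using Tendsto.const_mul (K : ℝ) hf)
  rw [Finset.mul_sum]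
  exact Finset.sum_le_sum fun i _ => hg.dist_le_mul _ _

theorem clm_comp {E F : Type*} [NormedAddCommGroup E] [NormedSpace ℝ E] [NormedAddCommGroup F]
    [NormedSpace ℝ F] {f : ℝ → E} {a b : ℝ} (g : E →L[ℝ] F)
    (hf : AbsolutelyContinuousOnInterval f a b) :
    AbsolutelyContinuousOnInterval (fun t => g (f t)) a b :=
  hf.lipschitz_comp g.lipschitz

theorem finset_sum {E ι : Type*} [NormedAddCommGroup E] {f : ι → ℝ → E} {a b : ℝ} (s : Finset ι)
    (hf : ∀ i ∈ s, AbsolutelyContinuousOnInterval (f i) a b) :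
    AbsolutelyContinuousOnInterval (fun t => ∑ i ∈ s, f i t) a b := by
  classical
  induction s using Finset.induction_on with
  | empty =>
    simpa using (LipschitzWith.const (0 : E)).lipschitzOnWith.absolutelyContinuousOnInterval
  | insert i s hi ih =>
    simp only [Finset.sum_insert hi]
    exact (hf i (Finset.mem_insert_self i s)).fun_add
      (ih fun j hj => hf j (Finset.mem_insert_of_mem hj))

/-- If the derivative of an absolutely continuous function is almost everywhere at most `m`, the
increments are at most `m` times the length of the interval. -/
theorem sub_le_of_ae_deriv_le {g : ℝ → ℝ} {a b m : ℝ} (hab : a ≤ b)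
    (hg : AbsolutelyContinuousOnInterval g a b)
    (h : ∀ᵐ t, t ∈ Ioo a b → ∃ d ≤ m, HasDerivAt g d t) : g b - g a ≤ m * (b - a) := by
  rw [← hg.integral_deriv_eq_sub]
  have h1 : ∫ x in a..b, deriv g x ≤ ∫ x in a..b, m := by
    refine intervalIntegral.integral_mono_ae_restrict hab hg.intervalIntegrable_deriv
      intervalIntegrable_const ?_
    rw [← restrict_Ioo_eq_restrict_Icc]
    refine (ae_restrict_iff' measurableSet_Ioo).2 ?_
    filter_upwards [h] with t ht hmem
    obtain ⟨d, hd, hd'⟩ := ht hmem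
    rwa [hd'.deriv]
  refine h1.trans (le_of_eq ?_)
  rw [intervalIntegral.integral_const, smul_eq_mul, mul_comm]

/-- Grönwall's inequality for an absolutely continuous function with `g' ≤ C g` almost
everywhere. -/
theorem le_mul_exp_of_ae_deriv_le {g : ℝ → ℝ} {a b C : ℝ} (hab : a ≤ b)
    (hg : AbsolutelyContinuousOnInterval g a b)
    (h : ∀ᵐ t, t ∈ Ioo a b → ∃ d ≤ C * g t, HasDerivAt g d t) :
    g b ≤ g a * Real.exp (C * (b - a)) := by
  have hexp : AbsolutelyContinuousOnInterval (fun t => Real.exp (-C * (t - a))) a b :=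
    ContDiffOn.absolutelyContinuousOnInterval (by fun_prop)
  have h1 := sub_le_of_ae_deriv_le (m := 0) hab (hg.fun_mul hexp) (by
    filter_upwards [h] with t ht hmem
    obtain ⟨d, hd, hd'⟩ := ht hmem
    have he : HasDerivAt (fun t => Real.exp (-C * (t - a))) (Real.exp (-C * (t - a)) * (-C)) t := by
      simpa using (((hasDerivAt_id t).sub_const a).const_mul (-C)).exp
    refine ⟨_, ?_, hd'.mul he⟩
    have := Real.exp_pos (-C * (t - a))
    nlinarith)
  have h2 : g b * Real.exp (-C * (b - a)) ≤ g a := by simpa using h1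
  have h3 := mul_le_mul_of_nonneg_right h2 (Real.exp_pos (C * (b - a))).le
  rwa [mul_assoc, ← Real.exp_add, show -C * (b - a) + C * (b - a) = 0 by ring, Real.exp_zero,
    mul_one] at h3

/-- A function that decreases at rate `c` wherever it exceeds the level `r` either stays above `r`
and decreases at rate `c` throughout, or ends up at most at `r`. -/
theorem le_max_of_ae_deriv_le {g : ℝ → ℝ} {a b r c : ℝ} (hab : a ≤ b) (hc : 0 ≤ c)
    (hg : AbsolutelyContinuousOnInterval g a b)
    (h : ∀ᵐ t, t ∈ Ioo a b → r < g t → ∃ d ≤ -c, HasDerivAt g d t) :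
    g b ≤ max (g a - c * (b - a)) r := by
  by_contra! hcon
  obtain ⟨h1, h2⟩ := max_lt_iff.1 hcon
  have hcont : ContinuousOn g (Icc a b) := by simpa [uIcc_of_le hab] using hg.continuousOn
  -- the last point `s` at which `g` is at most `r`
  rcases (Icc a b ∩ g ⁻¹' Iic r).eq_empty_or_nonempty with hemp | hne
  · have := sub_le_of_ae_deriv_le (m := -c) hab hg (by
      filter_upwards [h] with t ht hmem
      refine ht hmem (lt_of_not_ge fun hle => ?_)
      exact (hemp ▸ ⟨Ioo_subset_Icc_self hmem, hle⟩ : t ∈ (∅ : Set ℝ)))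
    linarith
  · have hcomp : IsCompact (Icc a b ∩ g ⁻¹' Iic r) :=
      isCompact_Icc.of_isClosed_subset 
        (hcont.preimage_isClosed_of_isClosed isClosed_Icc isClosed_Iic)
        inter_subset_left
    obtain ⟨s, ⟨hs, hsr⟩, hmax⟩ := hcomp.exists_isGreatest hne
    have hg' : AbsolutelyContinuousOnInterval g s b := hg.mono (by
      rw [uIcc_of_le hs.2, uIcc_of_le hab]
      exact Icc_subset_Icc_left hs.1)
    have := sub_le_of_ae_deriv_le (m := -c) hs.2 hg' (by
      filter_upwards [h] with t ht hmem
      refine ht ⟨hs.1.trans_lt hmem.1, hmem.2⟩ (lt_of_not_ge fun hle => ?_)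
      exact absurd (hmax ⟨⟨hs.1.trans hmem.1.le, hmem.2.le⟩, hle⟩) (not_le.2 hmem.1))
    have hsr' : g s ≤ r := hsr
    have : 0 ≤ c * (b - s) := mul_nonneg hc (sub_nonneg.2 hs.2)
    linarith

end AbsolutelyContinuousOnInterval

/-- A function that decreases at a positive rate wherever it exceeds the level `r` is eventually at
most `r`. -/
theorem eventually_le_of_ae_deriv_le {g : ℝ → ℝ} {r c t₀ : ℝ} (hc : 0 < c)
    (hg : ∀ t, t₀ ≤ t → AbsolutelyContinuousOnInterval g t₀ t)
    (h : ∀ᵐ t, t₀ < t → r < g t → ∃ d ≤ -c, HasDerivAt g d t) :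
    ∀ᶠ t in atTop, g t ≤ r := by
  filter_upwards [eventually_ge_atTop t₀, eventually_ge_atTop (t₀ + (g t₀ - r) / c)] with t h1 h2
  have h3 := (hg t h1).le_max_of_ae_deriv_le (r := r) h1 hc.le (by
    filter_upwards [h] with s hs hmem
    exact hs hmem.1)
  refine h3.trans (max_le ?_ le_rfl)
  have : (g t₀ - r) / c * c = g t₀ - r := div_mul_cancel₀ _ hc.ne'
  nlinarith

/-- A finite family of functions that start below `R`, each of which does not increase where it
exceeds the level `r < R` as long as all of them are at most `R`, stays below `R`. -/
theorem forall_lt_of_ae_deriv_nonpos {ι : Type*} [Finite ι] {g : ι → ℝ → ℝ} {r R : ℝ}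
    (hg : ∀ k t, 0 ≤ t → AbsolutelyContinuousOnInterval (g k) 0 t)
    (h0 : ∀ k, g k 0 < R) (hr : r < R)
    (h : ∀ᵐ t, 0 < t → (∀ k, g k t ≤ R) → ∀ k, r < g k t → ∃ d ≤ 0, HasDerivAt (g k) d t)
    {t : ℝ} (ht : 0 ≤ t) (k : ι) : g k t < R := by
  by_contra! hcon
  have hcont : ∀ k, ContinuousOn (g k) (Icc 0 t) := fun k => by
    simpa [uIcc_of_le ht] using (hg k t ht).continuousOn
  -- the first time at which one of the functions reaches `R`
  have hcomp : IsCompact (⋃ k, Icc 0 t ∩ g k ⁻¹' Ici R) :=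
    isCompact_iUnion fun k => isCompact_Icc.of_isClosed_subset
      ((hcont k).preimage_isClosed_of_isClosed isClosed_Icc isClosed_Ici) inter_subset_left
  obtain ⟨s, hs, hmin⟩ := hcomp.exists_isLeast ⟨t, mem_iUnion.2 ⟨k, ⟨ht, le_rfl⟩, hcon⟩⟩
  obtain ⟨j, hsI, hjR⟩ := mem_iUnion.1 hs
  have hjR' : R ≤ g j s := hjR
  have := (hg j s hsI.1).le_max_of_ae_deriv_le (r := r) (c := 0) hsI.1 le_rfl (by
    filter_upwards [h] with τ hτ hmem hrj
    simp only [neg_zero]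
    refine hτ hmem.1 (fun i => le_of_not_gt fun hi => ?_) j hrj
    exact absurd (hmin (mem_iUnion.2 ⟨i, ⟨hmem.1.le, hmem.2.le.trans hsI.2⟩, hi.le⟩))
      (not_le.2 hmem.2))
  have h1 := h0 j
  rcases le_max_iff.1 this with h2 | h2 <;> linarith

/-! ### The set-valued sign and Filippov regularizations -/

/-- The `e`-relaxed set-valued sign of the vector `y`: the `σ` with `|σ j| ≤ 1` and
`σ j * y j ≥ |y j| - e`. For `e = 0`, the entry `σ j` is the sign of `y j ≠ 0`, and it is anything
in `[-1, 1]` if `y j = 0`. The relaxation makes this set stable under perturbations of `y`. -/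
def signSet {J : Type*} (e : ℝ) (y : J → ℝ) : Set (J → ℝ) :=
  {σ | ∀ j, |σ j| ≤ 1 ∧ |y j| - e ≤ σ j * y j}

section SignSet

variable {J : Type*}

theorem signSet_perturb {e δ : ℝ} {y y' σ : J → ℝ} (hσ : σ ∈ signSet e y')
    (hy : ∀ j, |y' j - y j| ≤ δ) : σ ∈ signSet (e + 2 * δ) y := by
  intro j
  obtain ⟨h1, h2⟩ := hσ j
  refine ⟨h1, ?_⟩
  have h3 := hy j
  have h4 : |y j| ≤ |y' j| + |y' j - y j| := by
    have := abs_sub_abs_le_abs_sub (y j) (y' j)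
    rw [abs_sub_comm] at this
    linarith
  have h5 : σ j * (y' j - y j) ≤ |y' j - y j| := by
    refine (le_abs_self _).trans ?_
    rw [abs_mul]
    exact mul_le_of_le_one_left (abs_nonneg _) h1
  nlinarith

theorem sign_mem_signSet (y : J → ℝ) : (fun j => Real.sign (y j)) ∈ signSet 0 y := by
  intro j
  rcases lt_trichotomy (y j) 0 with h | h | h
  · simp [Real.sign_of_neg h, abs_of_neg h]
  · simp [h]
  · simp [Real.sign_of_pos h, abs_of_pos h]

theorem eq_one_of_mem_signSet {y σ : J → ℝ} (hσ : σ ∈ signSet 0 y) {j : J} (hj : 0 < y j) :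
    σ j = 1 := by
  obtain ⟨h1, h2⟩ := hσ j
  rw [abs_of_pos hj, sub_zero] at h2
  exact le_antisymm (abs_le.1 h1).2 (by nlinarith)

theorem eq_neg_one_of_mem_signSet {y σ : J → ℝ} (hσ : σ ∈ signSet 0 y) {j : J} (hj : y j < 0) :
    σ j = -1 := by
  obtain ⟨h1, h2⟩ := hσ j
  rw [abs_of_neg hj, sub_zero] at h2
  exact le_antisymm (by nlinarith) (abs_le.1 h1).1

/-- The relaxed set-valued sign is monotone up to the relaxations. -/
theorem signSet_monotone {e e' : ℝ} {y y' σ σ' : J → ℝ} (hσ : σ ∈ signSet e y)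
    (hσ' : σ' ∈ signSet e' y') (j : J) : -(e + e') ≤ (y j - y' j) * (σ j - σ' j) := by
  obtain ⟨h1, h2⟩ := hσ j
  obtain ⟨h3, h4⟩ := hσ' j
  have h5 : σ j * y' j ≤ |y' j| := (le_abs_self _).trans (by
    rw [abs_mul]; exact mul_le_of_le_one_left (abs_nonneg _) h1)
  have h6 : σ' j * y j ≤ |y j| := (le_abs_self _).trans (by
    rw [abs_mul]; exact mul_le_of_le_one_left (abs_nonneg _) h3)
  nlinarith

theorem convex_signSet (e : ℝ) (y : J → ℝ) : Convex ℝ (signSet e y) := by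
  intro σ hσ τ hτ a b ha hb hab j
  obtain ⟨h1, h2⟩ := hσ j
  obtain ⟨h3, h4⟩ := hτ j
  rw [abs_le] at h1 h3 ⊢
  simp only [Pi.add_apply, Pi.smul_apply, smul_eq_mul]
  refine ⟨⟨by nlinarith, by nlinarith⟩, ?_⟩
  have : |y j| - e = a * (|y j| - e) + b * (|y j| - e) := by rw [← add_mul, hab, one_mul]
  rw [this]
  nlinarith

theorem isClosed_signSet (e : ℝ) (y : J → ℝ) : IsClosed (signSet e y) := by
  simp only [signSet, ofPred_forall, ofPred_and]
  exact isClosed_iInter fun j =>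
    (isClosed_le (by fun_prop) continuous_const).inter (isClosed_le continuous_const (by fun_prop))

theorem isCompact_signSet (e : ℝ) (y : J → ℝ) : IsCompact (signSet e y) := by
  refine (isCompact_univ_pi fun _ : J => isCompact_Icc (a := (-1 : ℝ)) (b := 1)).of_isClosed_subset
    (isClosed_signSet e y) fun σ hσ j _ => abs_le.1 (hσ j).1

/-- The set-valued sign is the convex hull of the sign patterns `σ` compatible with `y`. -/
theorem signSet_zero_subset_convexHull [Finite J] (y : J → ℝ) :
    signSet 0 y ⊆ convexHull ℝ {σ | ∀ j, (σ j = 1 ∨ σ j = -1) ∧ 0 ≤ σ j * y j} := by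
  have h : {σ : J → ℝ | ∀ j, (σ j = 1 ∨ σ j = -1) ∧ 0 ≤ σ j * y j}
      = univ.pi fun j => {s : ℝ | (s = 1 ∨ s = -1) ∧ 0 ≤ s * y j} := by
    ext σ
    simp [Set.mem_pi]
  rw [h, convexHull_pi]
  intro σ hσ j _
  change σ j ∈ convexHull ℝ {s : ℝ | (s = 1 ∨ s = -1) ∧ 0 ≤ s * y j}
  rcases lt_trichotomy (y j) 0 with hj | hj | hj
  · rw [eq_neg_one_of_mem_signSet hσ hj]
    exact subset_convexHull _ _ ⟨Or.inr rfl, by linarith⟩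
  · have : ({s : ℝ | (s = 1 ∨ s = -1) ∧ 0 ≤ s * y j}) = {1, -1} := by
      ext s; simp [hj]
    rw [this, convexHull_pair, segment_symm, segment_eq_Icc (by norm_num)]
    exact abs_le.1 (hσ j).1
  · rw [eq_one_of_mem_signSet hσ hj]
    exact subset_convexHull _ _ ⟨Or.inl rfl, by linarith⟩

variable {E : Type*} [NormedAddCommGroup E] [NormedSpace ℝ E]

/-- The vectors within distance `ε` of the set of all `c + Ψ σ` with `σ` in the `ε`-relaxed
set-valued sign of `y`. -/
def signBand (Ψ : (J → ℝ) →L[ℝ] E) (c : E) (y : J → ℝ) (ε : ℝ) : Set E :=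
  (fun p : E × (J → ℝ) => c + (p.1 + Ψ p.2)) '' (Metric.closedBall 0 ε ×ˢ signSet ε y)

theorem convex_signBand (Ψ : (J → ℝ) →L[ℝ] E) (c : E) (y : J → ℝ) (ε : ℝ) :
    Convex ℝ (signBand Ψ c y ε) := by
  have h := (((convex_closedBall (0 : E) ε).prod (convex_signSet ε y)).linear_image
    ((ContinuousLinearMap.fst ℝ E (J → ℝ) + Ψ.comp (ContinuousLinearMap.snd ℝ E (J → ℝ))) :
      E × (J → ℝ) →ₗ[ℝ] E)).translate c
  rw [image_image] at h
  exact h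

theorem isClosed_signBand [FiniteDimensional ℝ E] (Ψ : (J → ℝ) →L[ℝ] E) (c : E) (y : J → ℝ)
    (ε : ℝ) : IsClosed (signBand Ψ c y ε) := by
  have : ProperSpace E := FiniteDimensional.proper ℝ E
  exact (((isCompact_closedBall (0 : E) ε).prod (isCompact_signSet ε y)).image
    (by fun_prop)).isClosed

/-- A vector which lies in all the bands around `c + Ψ (signSet 0 y)` lies in that set. -/
theorem exists_of_forall_mem_signBand {Ψ : (J → ℝ) →L[ℝ] E} {c d : E} {y : J → ℝ} [Finite J]
    (h : ∀ ε > 0, d ∈ signBand Ψ c y ε) : ∃ σ ∈ signSet 0 y, d = c + Ψ σ := by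
  have := Fintype.ofFinite J
  have hpos : ∀ k : ℕ, (0 : ℝ) < 1 / ((k : ℝ) + 1) := fun k => Nat.one_div_pos_of_nat
  choose p hp hpd using fun k : ℕ => h _ (hpos k)
  obtain ⟨σ, -, φ, hφ, hlim⟩ := (isCompact_univ_pi fun _ : J =>
    isCompact_Icc (a := (-1 : ℝ)) (b := 1)).tendsto_subseq (x := fun k => (p k).2)
    fun k j _ => abs_le.1 ((hp k).2 j).1
  have hε : Tendsto (fun k => 1 / (((φ k : ℕ) : ℝ) + 1)) atTop (𝓝 0) :=
    tendsto_one_div_add_atTop_nhds_zero_nat.comp hφ.tendsto_atTop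
  refine ⟨σ, fun j => ?_, ?_⟩
  · have hj : Tendsto (fun k => (p (φ k)).2 j) atTop (𝓝 (σ j)) := (tendsto_pi_nhds.1 hlim) j
    exact ⟨le_of_tendsto hj.abs (Eventually.of_forall fun k => ((hp (φ k)).2 j).1),
      le_of_tendsto_of_tendsto (tendsto_const_nhds.sub hε) (hj.mul_const (y j))
        (Eventually.of_forall fun k => ((hp (φ k)).2 j).2)⟩
  · have h1 : Tendsto (fun k => (p (φ k)).1) atTop (𝓝 0) :=
      squeeze_zero_norm (fun k => by simpa using (hp (φ k)).1) hε
    have h2 : Tendsto (fun k => c + ((p (φ k)).1 + Ψ (p (φ k)).2)) atTop (𝓝 (c + (0 + Ψ σ))) :=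
      (h1.add ((Ψ.continuous.tendsto σ).comp hlim)).const_add c
    rw [zero_add] at h2
    refine tendsto_nhds_unique ?_ h2
    simp only [hpd]
    exact tendsto_const_nhds

end SignSet

/-- If `f(t, x) = g x + Ψ (sign (h x))` with `g` continuous and the linear switching functions `h`
independent, then the Filippov regularization of `f` replaces the signs by the set-valued ones. -/
theorem mem_filippovMap_iff {E J : Type*} [NormedAddCommGroup E] [NormedSpace ℝ E]
    [FiniteDimensional ℝ E] [MeasureSpace E] [(volume : Measure E).IsOpenPosMeasure] [Fintype J]
    {f : ℝ → E → E} {t : ℝ} {g : E → E} (hg : Continuous g) (Ψ : (J → ℝ) →L[ℝ] E)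
    (h : E →L[ℝ] (J → ℝ)) (hsurj : Function.Surjective h)
    (hf : ∀ x, f t x = g x + Ψ fun j => Real.sign (h x j)) (x d : E) :
    d ∈ filippovMap f t x ↔ ∃ σ ∈ signSet 0 (h x), d = g x + Ψ σ := by
  constructor
  · intro hd
    refine exists_of_forall_mem_signBand fun ε hε => ?_
    obtain ⟨δ₁, hδ₁, h1⟩ := Metric.continuous_iff.1 hg x ε hε
    obtain ⟨δ₂, hδ₂, h2⟩ := Metric.continuous_iff.1 h.continuous x (ε / 2) (by positivity)
    simp only [filippovMap, mem_iInter] at hd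
    have hd' := hd (min δ₁ δ₂) (lt_min hδ₁ hδ₂) ∅ measure_empty
    refine closure_minimal (convexHull_min ?_ (convex_signBand Ψ (g x) (h x) ε))
      (isClosed_signBand Ψ (g x) (h x) ε) hd'
    rintro _ ⟨x', ⟨hx', -⟩, rfl⟩
    rw [Metric.mem_ball, lt_min_iff] at hx'
    refine ⟨(g x' - g x, fun j => Real.sign (h x' j)), ⟨?_, ?_⟩, ?_⟩
    · have := (h1 x' hx'.1).le
      simpa [dist_eq_norm] using this
    · have := signSet_perturb (y := h x) (δ := ε / 2) (sign_mem_signSet (h x')) fun j => by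
        rw [← Real.dist_eq]
        exact (dist_le_pi_dist _ _ j).trans (h2 x' hx'.2).le
      simpa [show 0 + 2 * (ε / 2) = ε by ring] using this
    · rw [hf]
      simp only
      abel
  · rintro ⟨σ, hσ, rfl⟩
    simp only [filippovMap, mem_iInter]
    intro δ hδ Z hZ
    have hvert : ∀ τ : J → ℝ, (∀ j, (τ j = 1 ∨ τ j = -1) ∧ 0 ≤ τ j * h x j) →
        g x + Ψ τ ∈ closure (f t '' (Metric.ball x δ \ Z)) := by
      intro τ hτ
      rw [Metric.mem_closure_iff]
      intro ε hε
      obtain ⟨δ', hδ', h1⟩ := Metric.continuous_iff.1 hg x ε hε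
      -- the points near `x` at which the signs of `h` are given by `τ` form an open set
      have hopen : IsOpen (Metric.ball x (min δ δ') ∩ {x' | ∀ j, 0 < τ j * h x' j}) := by
        refine Metric.isOpen_ball.inter ?_
        rw [ofPred_forall]
        exact isOpen_iInter_of_finite fun j => isOpen_lt continuous_const (by fun_prop)
      have hne : (Metric.ball x (min δ δ') ∩ {x' | ∀ j, 0 < τ j * h x' j}).Nonempty := by
        obtain ⟨w, hw⟩ := hsurj τ
        have hlim : Tendsto (fun s : ℝ => x + s • w) (𝓝[>] 0) (𝓝 x) := by
          have : Tendsto (fun s : ℝ => x + s • w) (𝓝 0) (𝓝 (x + (0 : ℝ) • w)) :=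
            Continuous.tendsto (by fun_prop) 0
          rw [zero_smul, add_zero] at this
          exact this.mono_left nhdsWithin_le_nhds
        obtain ⟨s, hs, hs0⟩ := ((hlim.eventually_mem (Metric.ball_mem_nhds x (lt_min hδ hδ'))).and
          self_mem_nhdsWithin).exists
        refine ⟨x + s • w, hs, fun j => ?_⟩
        have hs0' : (0 : ℝ) < s := hs0
        have hττ : τ j * τ j = 1 := by rcases (hτ j).1 with h | h <;> rw [h] <;> norm_num
        have h0 := (hτ j).2
        simp only [map_add, map_smul, hw, Pi.add_apply, Pi.smul_apply, smul_eq_mul]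
        have : τ j * (h x j + s * τ j) = τ j * h x j + s * (τ j * τ j) := by ring
        rw [this, hττ]
        linarith
      have hpos := hopen.measure_pos volume hne
      obtain ⟨x', hx', hx'Z⟩ :
          ((Metric.ball x (min δ δ') ∩ {x' | ∀ j, 0 < τ j * h x' j}) \ Z).Nonempty := by
        by_contra hcon
        rw [not_nonempty_iff_eq_empty, sdiff_eq_empty] at hcon
        exact hpos.ne' (measure_mono_null hcon hZ)
      obtain ⟨hball, hsign⟩ := hx'
      rw [Metric.mem_ball, lt_min_iff] at hball
      refine ⟨f t x', ⟨x', ⟨hball.1, hx'Z⟩, rfl⟩, ?_⟩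
      have hτ' : (fun j => Real.sign (h x' j)) = τ := by
        funext j
        have := hsign j
        rcases (hτ j).1 with h2 | h2 <;> rw [h2] at this ⊢
        · exact Real.sign_of_pos (by linarith)
        · exact Real.sign_of_neg (by linarith)
      rw [hf, hτ', dist_add_right, dist_comm]
      exact h1 x' hball.2
    have hsub : (fun τ => g x + Ψ τ) '' {τ | ∀ j, (τ j = 1 ∨ τ j = -1) ∧ 0 ≤ τ j * h x j}
        ⊆ closure (convexHull ℝ (f t '' (Metric.ball x δ \ Z))) := by
      rintro _ ⟨τ, hτ, rfl⟩
      exact closure_mono (subset_convexHull ℝ _) (hvert τ hτ)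
    have hconv := convexHull_min hsub (convex_convexHull ℝ _).closure
    refine hconv ?_
    have himg := AffineMap.image_convexHull
      (AffineMap.const ℝ (J → ℝ) (g x) + (Ψ : (J → ℝ) →ₗ[ℝ] E).toAffineMap)
      {τ | ∀ j, (τ j = 1 ∨ τ j = -1) ∧ 0 ≤ τ j * h x j}
    exact himg ▸ mem_image_of_mem _ (signSet_zero_subset_convexHull _ hσ)

/-! ### Global solutions of Lipschitz differential equations -/

section Lipschitz

variable {E : Type*} [NormedAddCommGroup E] [NormedSpace ℝ E]

/-- The radial retraction of a normed space onto the closed ball of radius `R` around `0`. -/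
def radialClamp (R : ℝ) (x : E) : E := (R / max R ‖x‖) • x

theorem radialClamp_of_norm_le {R : ℝ} (hR : 0 < R) {x : E} (hx : ‖x‖ ≤ R) :
    radialClamp R x = x := by
  rw [radialClamp, max_eq_left hx, div_self hR.ne', one_smul]

theorem norm_radialClamp_le {R : ℝ} (hR : 0 < R) (x : E) : ‖radialClamp R x‖ ≤ R := by
  have hm : 0 < max R ‖x‖ := lt_max_of_lt_left hR
  rw [radialClamp, norm_smul, Real.norm_of_nonneg (by positivity), div_mul_eq_mul_div,
    div_le_iff₀ hm]
  exact mul_le_mul_of_nonneg_left (le_max_right _ _) hR.le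

theorem norm_radialClamp_le_norm {R : ℝ} (hR : 0 < R) (x : E) : ‖radialClamp R x‖ ≤ ‖x‖ := by
  have hm : 0 < max R ‖x‖ := lt_max_of_lt_left hR
  rw [radialClamp, norm_smul, Real.norm_of_nonneg (by positivity)]
  exact mul_le_of_le_one_left (norm_nonneg _) ((div_le_one hm).2 (le_max_left _ _))

theorem lipschitzWith_radialClamp {R : ℝ} (hR : 0 < R) :
    LipschitzWith 2 (radialClamp R : E → E) := by
  refine LipschitzWith.of_dist_le_mul fun x y => ?_
  rw [dist_eq_norm, dist_eq_norm]
  have hx : 0 < max R ‖x‖ := lt_max_of_lt_left hR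
  have hy : 0 < max R ‖y‖ := lt_max_of_lt_left hR
  have hsplit : radialClamp R x - radialClamp R y
      = (R / max R ‖x‖) • (x - y)
        + (R / max R ‖x‖ * ((max R ‖y‖ - max R ‖x‖) / max R ‖y‖)) • y := by
    have : R / max R ‖y‖ = R / max R ‖x‖
        - R / max R ‖x‖ * ((max R ‖y‖ - max R ‖x‖) / max R ‖y‖) := by
      field_simp
      ring
    rw [radialClamp, radialClamp, this]
    module
  have hc : |R / max R ‖x‖| ≤ 1 := by
    rw [abs_of_nonneg (by positivity)]
    exact (div_le_one hx).2 (le_max_left _ _)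
  have h1 : ‖(R / max R ‖x‖) • (x - y)‖ ≤ ‖x - y‖ := by
    rw [norm_smul, Real.norm_eq_abs]
    exact mul_le_of_le_one_left (norm_nonneg _) hc
  have h2 : ‖(R / max R ‖x‖ * ((max R ‖y‖ - max R ‖x‖) / max R ‖y‖)) • y‖ ≤ ‖x - y‖ := by
    rw [norm_smul, Real.norm_eq_abs, abs_mul, mul_assoc]
    refine (mul_le_of_le_one_left (by positivity) hc).trans ?_
    rw [abs_div, abs_of_pos hy, div_mul_eq_mul_div, div_le_iff₀ hy]
    have h3 : |max R ‖y‖ - max R ‖x‖| ≤ ‖x - y‖ := by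
      rw [max_comm R, max_comm R, norm_sub_rev]
      exact (abs_max_sub_max_le_abs _ _ _).trans (abs_norm_sub_norm_le y x)
    exact mul_le_mul h3 (le_max_right _ _) (norm_nonneg _) (norm_nonneg _)
  rw [hsplit]
  refine (norm_add_le _ _).trans ?_
  simp only [NNReal.coe_ofNat]
  linarith

/-- A differential equation whose right-hand side is continuous in time and globally Lipschitz in
the state has solutions on every compact interval. The right-hand side is cut off outside a large
ball to apply the Picard-Lindelöf theorem, and Grönwall's inequality shows that the solution does
not notice. -/
theorem exists_solution_of_lipschitzWith [CompleteSpace E] {f : ℝ → E → E} {K : NNReal} {T : ℝ}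
    (hT : 0 ≤ T) (hlip : ∀ t ∈ Icc 0 T, LipschitzWith K (f t))
    (hcont : ∀ x, ContinuousOn (fun t => f t x) (Icc 0 T)) (x₀ : E) :
    ∃ α : ℝ → E, α 0 = x₀ ∧ ∀ t ∈ Icc 0 T, HasDerivWithinAt α (f t (α t)) (Icc 0 T) t := by
  obtain ⟨c, hc⟩ := isCompact_Icc.exists_bound_of_continuousOn (hcont 0)
  have hc0 : 0 ≤ c := (norm_nonneg _).trans (hc 0 ⟨le_rfl, hT⟩)
  have hlin : ∀ t ∈ Icc 0 T, ∀ x, ‖f t x‖ ≤ K * ‖x‖ + c := fun t ht x => by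
    have h1 := (hlip t ht).norm_sub_le x 0
    have h2 := hc t ht
    have h3 := norm_sub_norm_le (f t x) (f t 0)
    rw [sub_zero] at h1
    linarith
  set R : ℝ := gronwallBound ‖x₀‖ K c T + 1 with hRdef
  have hgb : ‖x₀‖ ≤ gronwallBound ‖x₀‖ K c T := by
    have := gronwallBound_mono (norm_nonneg x₀) hc0 K.coe_nonneg hT
    rwa [gronwallBound_x0] at this
  have hR : 0 < R := by have := norm_nonneg x₀; linarith
  set F : ℝ → E → E := fun t x => f t (radialClamp R x) with hF
  have hFb : ∀ t ∈ Icc 0 T, ∀ x, ‖F t x‖ ≤ K * ‖x‖ + c := fun t ht x =>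
    (hlin t ht _).trans (by gcongr; exact norm_radialClamp_le_norm hR x)
  have hFb' : ∀ t ∈ Icc 0 T, ∀ x, ‖F t x‖ ≤ K * R + c := fun t ht x =>
    (hlin t ht _).trans (by gcongr; exact norm_radialClamp_le hR x)
  have hPL : IsPicardLindelof F (tmin := 0) (tmax := T) ⟨0, le_rfl, hT⟩ x₀
      (((K * R + c) * T).toNNReal) 0 ((K * R + c).toNNReal) (K * 2) :=
    { lipschitzOnWith := fun t ht =>
        ((hlip t ht).comp (lipschitzWith_radialClamp hR)).lipschitzOnWith
      continuousOn := fun x _ => hcont _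
      norm_le := fun t ht x _ => (hFb' t ht x).trans (Real.le_coe_toNNReal _)
      mul_max_le := by
        have h1 : 0 ≤ K * R + c := by positivity
        simp [Real.coe_toNNReal _ h1, Real.coe_toNNReal _ (mul_nonneg h1 hT), hT] }
  obtain ⟨α, hα0, hα⟩ := hPL.exists_eq_forall_mem_Icc_hasDerivWithinAt₀
  have hbound : ∀ t ∈ Icc 0 T, ‖α t‖ ≤ R := fun t ht => by
    have h1 := norm_le_gronwallBound_of_norm_deriv_right_le (f := α) (f' := fun t => F t (α t))
      (δ := ‖x₀‖) (K := K) (ε := c) (a := 0) (b := T)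
      (fun t ht => (hα t ht).continuousWithinAt)
      (fun t ht => (hα t (Ico_subset_Icc_self ht)).mono_of_mem_nhdsWithin
        (Icc_mem_nhdsGE_of_mem ht))
      (by simp at hα0; rw [hα0]) (fun t ht => hFb t (Ico_subset_Icc_self ht) _) t ht
    have h2 := gronwallBound_mono (norm_nonneg x₀) hc0 K.coe_nonneg ht.2
    rw [sub_zero] at h1
    linarith
  refine ⟨α, hα0, fun t ht => ?_⟩
  have := hα t ht
  simp only [hF] at this
  rwa [radialClamp_of_norm_le hR (hbound t ht)] at this

end Lipschitz

/-! ### Calculus of vector-valued functions -/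

section Calculus

variable {E : Type*} [NormedAddCommGroup E] [NormedSpace ℝ E]

/-- The mean value theorem for derivatives in a closed convex set. -/
theorem slope_mem_of_hasDerivAt_mem {f f' : ℝ → E} {s : Set E} (hs : Convex ℝ s)
    (hs' : IsClosed s) {a b : ℝ} (hab : a < b) (hf : ContinuousOn f (Icc a b))
    (hf' : ∀ t ∈ Ioo a b, HasDerivAt f (f' t) t) (hmem : ∀ t ∈ Ioo a b, f' t ∈ s) :
    slope f a b ∈ s := by
  by_contra hcon
  obtain ⟨ℓ, u, h1, h2⟩ := geometric_hahn_banach_point_closed hs hs' hcon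
  obtain ⟨c, hc, hc'⟩ := exists_hasDerivAt_eq_slope (fun t => ℓ (f t)) (fun t => ℓ (f' t)) hab
    (ℓ.continuous.comp_continuousOn hf) fun t ht => ℓ.hasFDerivAt.comp_hasDerivAt t (hf' t ht)
  have h3 := h2 _ (hmem c hc)
  rw [slope_def_module, map_smul, map_sub, smul_eq_mul, inv_mul_eq_div, ← hc'] at h1
  exact lt_asymm h1 h3

theorem AbsolutelyContinuousOnInterval.congr {X : Type*} [PseudoMetricSpace X] {f g : ℝ → X}
    {a b : ℝ} (hf : AbsolutelyContinuousOnInterval f a b) (h : EqOn f g (uIcc a b)) :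
    AbsolutelyContinuousOnInterval g a b := by
  refine Tendsto.congr' (eventually_inf_principal.2 (Eventually.of_forall fun I hI => ?_)) hf
  refine Finset.sum_congr rfl fun i hi => ?_
  rw [h (hI.1 i hi).1, h (hI.1 i hi).2]

theorem AbsolutelyContinuousOnInterval.of_forall_clm [FiniteDimensional ℝ E] {f : ℝ → E}
    {a b : ℝ} (h : ∀ ℓ : E →L[ℝ] ℝ, AbsolutelyContinuousOnInterval (fun t => ℓ (f t)) a b) :
    AbsolutelyContinuousOnInterval f a b := by
  let v := Module.finBasis ℝ E
  have hf : f = fun t => ∑ i, (v.coord i).toContinuousLinearMap (f t) • v i := by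
    funext t
    exact (v.sum_repr (f t)).symm
  rw [hf]
  exact finset_sum _ fun i _ => (h (v.coord i).toContinuousLinearMap).fun_smul
    (LipschitzWith.const (v i)).lipschitzOnWith.absolutelyContinuousOnInterval

theorem AbsolutelyContinuousOnInterval.ae_differentiableAt_of_finiteDimensional
    [FiniteDimensional ℝ E] {f : ℝ → E} {a b : ℝ} (hf : AbsolutelyContinuousOnInterval f a b) :
    ∀ᵐ t, t ∈ uIcc a b → DifferentiableAt ℝ f t := by
  let v := Module.finBasis ℝ E
  have hv : f = fun t => ∑ i, (v.coord i).toContinuousLinearMap (f t) • v i := by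
    funext t
    exact (v.sum_repr (f t)).symm
  have h := ae_all_iff.2 fun i =>
    (hf.clm_comp (v.coord i).toContinuousLinearMap).ae_differentiableAt
  filter_upwards [h] with t ht hmem
  rw [hv]
  exact DifferentiableAt.fun_sum fun i _ => (ht i hmem).smul_const _

theorem IntervalIntegrable.absolutelyContinuousOnInterval_primitive [FiniteDimensional ℝ E]
    {f : ℝ → E} {a b : ℝ} (hf : IntervalIntegrable f volume a b) :
    AbsolutelyContinuousOnInterval (fun t => ∫ s in a..t, f s) a b := by
  have := FiniteDimensional.complete ℝ E
  refine .of_forall_clm fun ℓ => ?_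
  have hint : IntervalIntegrable (fun s => ℓ (f s)) volume a b :=
    ⟨ℓ.integrable_comp hf.1, ℓ.integrable_comp hf.2⟩
  have h1 := hint.absolutelyContinuousOnInterval_intervalIntegral (c := a) left_mem_uIcc
  exact h1.congr fun t ht => ℓ.intervalIntegral_comp_comm
    (hf.mono_set (uIcc_subset_uIcc_left ht))

end Calculus

/-! ### Linear systems with passive set-valued feedback -/

section Inclusion

set_option linter.unusedSectionVars false

variable {E J ι : Type*} [NormedAddCommGroup E] [NormedSpace ℝ E]
  [Fintype J] [Fintype ι]

theorem hasDerivWithinAt_energy {φ : E →L[ℝ] (ι → ℝ)} {D : ℝ → E} {d : E} {s : Set ℝ} {t : ℝ}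
    (hD : HasDerivWithinAt D d s t) :
    HasDerivWithinAt (fun t => φ (D t) ⬝ᵥ φ (D t)) (2 * (φ (D t) ⬝ᵥ φ d)) s t := by
  have h1 : HasDerivWithinAt (fun t => φ (D t)) (φ d) s t :=
    φ.hasFDerivAt.comp_hasDerivWithinAt t hD
  have h2 := HasDerivWithinAt.fun_sum (u := Finset.univ) fun i _ =>
    (hasDerivWithinAt_pi.1 h1 i).mul (hasDerivWithinAt_pi.1 h1 i)
  refine h2.congr_deriv ?_
  rw [dotProduct, Finset.mul_sum]
  exact Finset.sum_congr rfl fun i _ => by ring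

theorem AbsolutelyContinuousOnInterval.energy {φ : E →L[ℝ] (ι → ℝ)} {D : ℝ → E} {a b : ℝ}
    (hD : AbsolutelyContinuousOnInterval D a b) :
    AbsolutelyContinuousOnInterval (fun t => φ (D t) ⬝ᵥ φ (D t)) a b := by
  refine finset_sum _ fun i _ => ?_
  have h := hD.clm_comp ((ContinuousLinearMap.proj i : (ι → ℝ) →L[ℝ] ℝ).comp φ)
  exact h.fun_mul h

/-- The energy `φ x ⬝ᵥ φ x` of an injective `φ` dominates the squared norm. -/
theorem exists_norm_sq_le_energy [FiniteDimensional ℝ E] {φ : E →L[ℝ] (ι → ℝ)}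
    (hφ : Function.Injective φ) :
    ∃ c, 0 < c ∧ ∀ x, ‖x‖ ^ 2 ≤ c * (φ x ⬝ᵥ φ x) := by
  obtain ⟨K, hK, hanti⟩ := LinearMap.exists_antilipschitzWith (φ : E →ₗ[ℝ] (ι → ℝ))
    (LinearMap.ker_eq_bot.2 hφ)
  refine ⟨(K : ℝ) ^ 2, by positivity, fun x => ?_⟩
  have h1 : ‖x‖ ≤ K * ‖φ x‖ := by
    have := hanti.le_mul_dist x 0
    simpa [dist_eq_norm] using this
  have h2 : ‖φ x‖ ^ 2 ≤ φ x ⬝ᵥ φ x := by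
    have h0 : 0 ≤ φ x ⬝ᵥ φ x := Finset.sum_nonneg fun i _ => mul_self_nonneg _
    refine (Real.le_sqrt (norm_nonneg _) h0).1 ?_
    refine (pi_norm_le_iff_of_nonneg (Real.sqrt_nonneg _)).2 fun i => Real.abs_le_sqrt ?_
    rw [sq]
    exact Finset.single_le_sum (f := fun i => φ x i * φ x i) (fun i _ => mul_self_nonneg _)
      (Finset.mem_univ i)
  calc ‖x‖ ^ 2 ≤ (K * ‖φ x‖) ^ 2 := by gcongr
    _ = K ^ 2 * ‖φ x‖ ^ 2 := by ring
    _ ≤ K ^ 2 * (φ x ⬝ᵥ φ x) := by gcongr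

/-- One-sided Lipschitz estimate: for a linear field with a feedback through relaxed signs which is
passive for the energy `φ x ⬝ᵥ φ x`, the derivative of the energy of the difference of two solutions
is bounded by a multiple of that energy, up to the relaxations. -/
theorem exists_energy_deriv_le [FiniteDimensional ℝ E] {φ : E →L[ℝ] (ι → ℝ)}
    (hφ : Function.Injective φ)
    (Λ : E →L[ℝ] E) {Ψ : (J → ℝ) →L[ℝ] E} {h : E →L[ℝ] (J → ℝ)} {k : J → ℝ} (hk : ∀ j, 0 ≤ k j)
    (hpass : ∀ x σ, φ x ⬝ᵥ φ (Ψ σ) = -∑ j, k j * (h x j * σ j)) :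
    ∃ C, 0 < C ∧ ∀ e e' x y, 0 ≤ e → 0 ≤ e' → ∀ σ ∈ signSet e (h x), ∀ σ' ∈ signSet e' (h y),
      2 * (φ (x - y) ⬝ᵥ φ ((Λ x + Ψ σ) - (Λ y + Ψ σ')))
        ≤ C * (φ (x - y) ⬝ᵥ φ (x - y)) + C * (e + e') := by
  obtain ⟨c, hc, hc'⟩ := exists_norm_sq_le_energy hφ
  set C₁ : ℝ := 2 * (Fintype.card ι * ‖φ‖ ^ 2 * ‖Λ‖ * c) with hC₁
  set C₂ : ℝ := 2 * ∑ j, k j with hC₂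
  have h1 : 0 ≤ C₁ := by positivity
  have h2 : 0 ≤ C₂ := mul_nonneg zero_le_two (Finset.sum_nonneg fun j _ => hk j)
  refine ⟨C₁ + C₂ + 1, by positivity, fun e e' x y he he' σ hσ σ' hσ' => ?_⟩
  have hsplit : (Λ x + Ψ σ) - (Λ y + Ψ σ') = Λ (x - y) + Ψ (σ - σ') := by
    rw [map_sub, map_sub]; abel
  have hq : 0 ≤ φ (x - y) ⬝ᵥ φ (x - y) := Finset.sum_nonneg fun i _ => mul_self_nonneg _
  have hlin : 2 * (φ (x - y) ⬝ᵥ φ (Λ (x - y))) ≤ C₁ * (φ (x - y) ⬝ᵥ φ (x - y)) := by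
    have h3 : φ (x - y) ⬝ᵥ φ (Λ (x - y)) ≤ Fintype.card ι * (‖φ‖ ^ 2 * ‖Λ‖ * ‖x - y‖ ^ 2) := by
      rw [dotProduct, ← nsmul_eq_mul]
      refine Finset.sum_le_card_nsmul _ _ _ fun i _ => ?_
      refine (le_abs_self _).trans ?_
      rw [abs_mul]
      have h4 : |φ (x - y) i| ≤ ‖φ‖ * ‖x - y‖ := (norm_le_pi_norm _ i).trans (φ.le_opNorm _)
      have h5 : |φ (Λ (x - y)) i| ≤ ‖φ‖ * (‖Λ‖ * ‖x - y‖) :=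
        (norm_le_pi_norm _ i).trans ((φ.le_opNorm _).trans (by gcongr; exact Λ.le_opNorm _))
      calc _ ≤ (‖φ‖ * ‖x - y‖) * (‖φ‖ * (‖Λ‖ * ‖x - y‖)) := by gcongr
        _ = _ := by ring
    have h4 := mul_le_mul_of_nonneg_left (hc' (x - y))
      (by positivity : 0 ≤ Fintype.card ι * (‖φ‖ ^ 2 * ‖Λ‖))
    rw [hC₁]
    linarith
  have hsgn : 2 * (φ (x - y) ⬝ᵥ φ (Ψ (σ - σ'))) ≤ C₂ * (e + e') := by
    rw [hpass, hC₂, mul_assoc, Finset.sum_mul, ← Finset.sum_neg_distrib]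
    refine mul_le_mul_of_nonneg_left (Finset.sum_le_sum fun j _ => ?_) zero_le_two
    have := mul_le_mul_of_nonneg_left (signSet_monotone hσ hσ' j) (hk j)
    simp only [map_sub, Pi.sub_apply]
    linarith
  rw [hsplit, map_add, dotProduct_add]
  nlinarith

/-- Uniqueness of the solution of a linear system with passive set-valued sign feedback. -/
theorem eq_of_passive_signSet [FiniteDimensional ℝ E] {φ : E →L[ℝ] (ι → ℝ)}
    (hφ : Function.Injective φ)
    {Λ : E →L[ℝ] E} {Ψ : (J → ℝ) →L[ℝ] E} {h : E →L[ℝ] (J → ℝ)} {k : J → ℝ} (hk : ∀ j, 0 ≤ k j)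
    (hpass : ∀ x σ, φ x ⬝ᵥ φ (Ψ σ) = -∑ j, k j * (h x j * σ j)) {b : ℝ → E} {T : ℝ} {X Y : ℝ → E}
    (hX : AbsolutelyContinuousOnInterval X 0 T) (hY : AbsolutelyContinuousOnInterval Y 0 T)
    (hX' : ∀ᵐ t, t ∈ Ioo 0 T → ∃ σ ∈ signSet 0 (h (X t)), HasDerivAt X (Λ (X t) + b t + Ψ σ) t)
    (hY' : ∀ᵐ t, t ∈ Ioo 0 T → ∃ σ ∈ signSet 0 (h (Y t)), HasDerivAt Y (Λ (Y t) + b t + Ψ σ) t)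
    (hT : 0 ≤ T) (h0 : X 0 = Y 0) : X T = Y T := by
  obtain ⟨C, -, hC⟩ := exists_energy_deriv_le hφ Λ hk hpass
  have h1 := (hX.fun_sub hY).energy (φ := φ) |>.le_mul_exp_of_ae_deriv_le (C := C) hT (by
    filter_upwards [hX', hY'] with t htX htY hmem
    obtain ⟨σ, hσ, hXd⟩ := htX hmem
    obtain ⟨σ', hσ', hYd⟩ := htY hmem
    have h2 := hC 0 0 (X t) (Y t) le_rfl le_rfl σ hσ σ' hσ'
    have h3 := (hasDerivWithinAt_energy (φ := φ)
      (hXd.sub hYd).hasDerivWithinAt (s := univ)).hasDerivAt univ_mem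
    refine ⟨_, ?_, h3⟩
    simp only [add_zero, mul_zero] at h2
    rwa [add_right_comm (Λ (X t)), add_right_comm (Λ (Y t)), add_sub_add_right_eq_sub])
  simp only [h0, sub_self, map_zero, zero_dotProduct, zero_mul] at h1
  have h2 : φ (X T - Y T) ⬝ᵥ φ (X T - Y T) = 0 :=
    le_antisymm h1 (Finset.sum_nonneg fun i _ => mul_self_nonneg _)
  exact sub_eq_zero.1 (hφ (by rw [dotProduct_self_eq_zero.1 h2, map_zero]))

/-- The saturation with slope `m`, which is a Lipschitz approximation of the sign. -/
def saturation (m x : ℝ) : ℝ := max (-1) (min 1 (m * x))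

theorem saturation_mem_signSet {m : ℝ} (hm : 0 < m) (y : J → ℝ) :
    (fun j => saturation m (y j)) ∈ signSet (1 / m) y := by
  intro j
  simp only [saturation]
  generalize y j = x
  have h1 : m * (1 / m) = 1 := mul_one_div_cancel hm.ne'
  have h2 : 0 < 1 / m := by positivity
  refine ⟨abs_le.2 ⟨le_max_left _ _, max_le (by norm_num) (min_le_left _ _)⟩, ?_⟩
  rcases le_total (m * x) (-1) with h | h
  · rw [min_eq_right (by linarith), max_eq_left h, abs_of_nonpos (by nlinarith)]
    linarith
  · rcases le_total 1 (m * x) with h' | h'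
    · rw [min_eq_left h', max_eq_right (by norm_num), abs_of_nonneg (by nlinarith)]
      linarith
    · rw [min_eq_right h', max_eq_right h]
      have : |x| ≤ 1 / m := by
        rw [le_div_iff₀ hm, ← abs_of_pos hm, ← abs_mul, abs_le, mul_comm]
        exact ⟨h, h'⟩
      nlinarith [mul_self_nonneg x]

theorem lipschitzWith_saturation {m : ℝ} (hm : 0 ≤ m) :
    LipschitzWith m.toNNReal (saturation m) := by
  refine LipschitzWith.const_max (LipschitzWith.const_min ?_ _) _
  refine LipschitzWith.of_dist_le_mul fun x y => ?_
  rw [Real.dist_eq, Real.dist_eq, ← mul_sub, abs_mul, Real.coe_toNNReal _ hm, abs_of_nonneg hm]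

/-- The system with the sign replaced by the saturation of slope `m` has solutions. A merely
integrable inhomogeneity is moved into the shift by its primitive `β`, which makes the right-hand
side continuous in time. -/
theorem exists_saturated_solution [CompleteSpace E] (Λ : E →L[ℝ] E) (Ψ : (J → ℝ) →L[ℝ] E)
    (h : E →L[ℝ] (J → ℝ)) {β : ℝ → E} (x₀ : E) {T m : ℝ} (hT : 0 ≤ T) (hm : 0 ≤ m)
    (hβ : ContinuousOn β (Icc 0 T)) :
    ∃ P : ℝ → E, P 0 = x₀ ∧ ∀ t ∈ Icc 0 T, HasDerivWithinAt P
      (Λ (P t + β t) + Ψ fun j => saturation m (h (P t + β t) j)) (Icc 0 T) t := by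
  have hsat : LipschitzWith m.toNNReal fun y : J → ℝ => fun j => saturation m (y j) := by
    refine LipschitzWith.of_dist_le_mul fun y y' => ?_
    refine (dist_pi_le_iff (by positivity)).2 fun j => ?_
    exact ((lipschitzWith_saturation hm).dist_le_mul _ _).trans
      (mul_le_mul_of_nonneg_left (dist_le_pi_dist y y' j) (NNReal.coe_nonneg _))
  have hF : LipschitzWith (‖Λ‖₊ + ‖Ψ‖₊ * (m.toNNReal * ‖h‖₊))
      fun x => Λ x + Ψ fun j => saturation m (h x j) :=
    Λ.lipschitz.add (Ψ.lipschitz.comp (hsat.comp h.lipschitz))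
  refine exists_solution_of_lipschitzWith (K := ‖Λ‖₊ + ‖Ψ‖₊ * (m.toNNReal * ‖h‖₊))
    (f := fun t x => Λ (x + β t) + Ψ fun j => saturation m (h (x + β t) j)) hT
    (fun t _ => ?_) (fun x => ?_) x₀
  · have := hF.comp ((LipschitzWith.id (α := E)).add (LipschitzWith.const (β t)))
    rw [add_zero, mul_one] at this
    exact this
  · exact hF.continuous.comp_continuousOn (hβ.const_add x)

/-- The solutions for two saturations are close to each other, because the feedback through the
saturations is passive up to an error that vanishes as the slopes tend to infinity. -/
theorem exists_saturated_solution_dist_le [FiniteDimensional ℝ E] {φ : E →L[ℝ] (ι → ℝ)}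
    (hφ : Function.Injective φ)
    (Λ : E →L[ℝ] E) {Ψ : (J → ℝ) →L[ℝ] E} {h : E →L[ℝ] (J → ℝ)} {k : J → ℝ} (hk : ∀ j, 0 ≤ k j)
    (hpass : ∀ x σ, φ x ⬝ᵥ φ (Ψ σ) = -∑ j, k j * (h x j * σ j)) (β : ℝ → E) (T : ℝ) :
    ∃ M, 0 ≤ M ∧ ∀ (m m' : ℝ) (P P' : ℝ → E), 0 < m → 0 < m' → P 0 = P' 0 →
      (∀ t ∈ Icc 0 T, HasDerivWithinAt P
        (Λ (P t + β t) + Ψ fun j => saturation m (h (P t + β t) j)) (Icc 0 T) t) →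
      (∀ t ∈ Icc 0 T, HasDerivWithinAt P'
        (Λ (P' t + β t) + Ψ fun j => saturation m' (h (P' t + β t) j)) (Icc 0 T) t) →
      ∀ t ∈ Icc 0 T, ‖P t - P' t‖ ^ 2 ≤ M * (1 / m + 1 / m') := by
  obtain ⟨C, hC0, hC⟩ := exists_energy_deriv_le hφ Λ hk hpass
  obtain ⟨c, hc0, hc⟩ := exists_norm_sq_le_energy hφ
  refine ⟨c * (Real.exp (C * max T 0) - 1), ?_, ?_⟩
  · have := Real.one_le_exp (x := C * max T 0) (by positivity)
    exact mul_nonneg hc0.le (by linarith)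
  intro m m' P P' hm hm' h0 hP hP' t ht
  have hD : ∀ t ∈ Icc 0 T, HasDerivWithinAt (fun t => φ (P t - P' t) ⬝ᵥ φ (P t - P' t)) _
      (Icc 0 T) t := fun t ht => hasDerivWithinAt_energy (φ := φ) ((hP t ht).sub (hP' t ht))
  have h1 := le_gronwallBound_of_liminf_deriv_right_le (δ := 0) (K := C)
    (ε := C * (1 / m + 1 / m'))
    (fun t ht => (hD t ht).continuousWithinAt)
    (fun t ht r hr => ((hD t (Ico_subset_Icc_self ht)).mono_of_mem_nhdsWithin
        (Icc_mem_nhdsGE_of_mem ht)).liminf_right_slope_le hr)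
    (by simp [h0])
    (fun t ht => by
      have := hC (1 / m) (1 / m') (P t + β t) (P' t + β t) (by positivity) (by positivity)
        _ (saturation_mem_signSet hm _) _ (saturation_mem_signSet hm' _)
      rw [add_sub_add_right_eq_sub] at this
      exact this) t ht
  rw [gronwallBound_of_K_ne_0 hC0.ne'] at h1
  simp only at h1
  rw [zero_mul, zero_add, sub_zero, mul_div_assoc,
    mul_div_cancel₀ _ hC0.ne'] at h1
  have h2 : Real.exp (C * t) ≤ Real.exp (C * max T 0) :=
    Real.exp_le_exp.2 (mul_le_mul_of_nonneg_left (ht.2.trans (le_max_left _ _)) hC0.le)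
  have h3 : 0 ≤ 1 / m + 1 / m' := by positivity
  calc _ ≤ c * (φ (P t - P' t) ⬝ᵥ φ (P t - P' t)) := hc _
    _ ≤ c * ((1 / m + 1 / m') * (Real.exp (C * max T 0) - 1)) := by
        refine mul_le_mul_of_nonneg_left (h1.trans ?_) hc0.le
        exact mul_le_mul_of_nonneg_left (by linarith) h3
    _ = _ := by ring

/-- If solutions of the saturated systems converge uniformly on an interval, as the slopes tend to
infinity, then the derivative of the limit satisfies the inclusion. -/
theorem exists_signSet_of_tendsto_saturated [FiniteDimensional ℝ E] {Λ : E →L[ℝ] E}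
    {Ψ : (J → ℝ) →L[ℝ] E} {h : E →L[ℝ] (J → ℝ)} {β : ℝ → E} {T : ℝ} {P : ℕ → ℝ → E} {Q : ℝ → E}
    (hβ : ContinuousOn β (Icc 0 T))
    (hP : ∀ᶠ k : ℕ in atTop, ∀ t ∈ Icc 0 T, HasDerivWithinAt (P k)
      (Λ (P k t + β t) + Ψ fun j => saturation (k + 1) (h (P k t + β t) j)) (Icc 0 T) t)
    (hlim : TendstoUniformlyOn P Q atTop (Icc 0 T)) {t : ℝ} (ht : t ∈ Ioo 0 T) {d : E}
    (hd : HasDerivAt Q d t) : ∃ σ ∈ signSet 0 (h (Q t + β t)), d = Λ (Q t + β t) + Ψ σ := by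
  refine exists_of_forall_mem_signBand fun ε hε => ?_
  set B : ℝ := ‖Λ‖ + ‖h‖ + 1 with hB
  have hB0 : 0 < B := by positivity
  set r : ℝ := ε / (8 * B) with hr
  have hr0 : 0 < r := by positivity
  have hBr : B * r = ε / 8 := by rw [hr]; field_simp
  have hcontQ : ContinuousAt Q t := hd.continuousAt
  have hcontβ : ContinuousAt β t := hβ.continuousAt (Icc_mem_nhds ht.1 ht.2)
  obtain ⟨δ, hδ, hδQ⟩ := Metric.continuousAt_iff.1 (hcontQ.add hcontβ) r hr0
  have hev : ∀ᶠ k : ℕ in atTop, (∀ t ∈ Icc 0 T, HasDerivWithinAt (P k)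
      (Λ (P k t + β t) + Ψ fun j => saturation (k + 1) (h (P k t + β t) j)) (Icc 0 T) t) ∧
      (∀ s ∈ Icc 0 T, dist (Q s) (P k s) < r) ∧ 1 / ((k : ℝ) + 1) < ε / 2 :=
    hP.and ((Metric.tendstoUniformlyOn_iff.1 hlim r hr0).and
      (tendsto_one_div_add_atTop_nhds_zero_nat.eventually_lt_const (by positivity)))
  -- near `t`, the derivatives of the approximate solutions lie in the band
  have hband : ∀ᶠ k : ℕ in atTop, ∀ s ∈ Ioo t (min (t + δ) T),
      slope (P k) t s ∈ signBand Ψ (Λ (Q t + β t)) (h (Q t + β t)) ε := by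
    filter_upwards [hev] with k hk s hs
    obtain ⟨hk1, hk2, hk3⟩ := hk
    have hsT : s < T := hs.2.trans_le (min_le_right _ _)
    have hsδ : s < t + δ := hs.2.trans_le (min_le_left _ _)
    refine slope_mem_of_hasDerivAt_mem (convex_signBand _ _ _ _) (isClosed_signBand _ _ _ _) hs.1
      (fun τ hτ => ((hk1 τ ⟨ht.1.le.trans hτ.1, hτ.2.trans hsT.le⟩).continuousWithinAt).mono
        (Icc_subset_Icc ht.1.le hsT.le))
      (fun τ hτ => (hk1 τ ⟨(ht.1.trans hτ.1).le, (hτ.2.trans hsT).le⟩).hasDerivAt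
        (Icc_mem_nhds (ht.1.trans hτ.1) (hτ.2.trans hsT))) fun τ hτ => ?_
    have hclose : ‖(P k τ + β τ) - (Q t + β t)‖ ≤ 2 * r := by
      have h1 := (hk2 τ ⟨(ht.1.trans hτ.1).le, (hτ.2.trans hsT).le⟩).le
      have h2 := (hδQ (x := τ) (by
        rw [Real.dist_eq, abs_of_pos (sub_pos.2 hτ.1)]; linarith [hτ.2])).le
      rw [dist_comm, dist_eq_norm] at h1
      rw [dist_eq_norm] at h2
      calc _ = ‖(P k τ - Q τ) + ((Q τ + β τ) - (Q t + β t))‖ := by congr 1; abel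
        _ ≤ _ := (norm_add_le _ _).trans (by rw [two_mul]; exact add_le_add h1 h2)
    refine ⟨(Λ ((P k τ + β τ) - (Q t + β t)), fun j => saturation (k + 1) (h (P k τ + β τ) j)),
      ⟨?_, ?_⟩, ?_⟩
    · rw [mem_closedBall_zero_iff]
      have h3 := (Λ.le_opNorm ((P k τ + β τ) - (Q t + β t))).trans
        (mul_le_mul_of_nonneg_left hclose (norm_nonneg _))
      have h4 : ‖Λ‖ * r ≤ B * r := by
        gcongr; rw [hB]; linarith [norm_nonneg h]
      linarith
    · have h5 := signSet_perturb (y := h (Q t + β t)) (δ := ε / 4)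
        (saturation_mem_signSet (m := (k : ℝ) + 1) (by positivity) (h (P k τ + β τ))) fun j => by
          rw [← Pi.sub_apply, ← map_sub]
          refine (norm_le_pi_norm (h _) j).trans ?_
          have h3 := (h.le_opNorm ((P k τ + β τ) - (Q t + β t))).trans
            (mul_le_mul_of_nonneg_left hclose (norm_nonneg _))
          have h4 : ‖h‖ * r ≤ B * r := by
            gcongr; rw [hB]; linarith [norm_nonneg Λ]
          linarith
      exact fun j => ⟨(h5 j).1, by have := (h5 j).2; linarith⟩
    · simp only [map_sub]
      abel
  have hslope : ∀ s ∈ Ioo t (min (t + δ) T),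
      slope Q t s ∈ signBand Ψ (Λ (Q t + β t)) (h (Q t + β t)) ε := by
    intro s hs
    have hsT : s < T := hs.2.trans_le (min_le_right _ _)
    have h1 := hlim.tendsto_at (Ioo_subset_Icc_self ht)
    have h2 := hlim.tendsto_at (x := s) ⟨(ht.1.trans hs.1).le, hsT.le⟩
    refine (isClosed_signBand _ _ _ _).mem_of_tendsto (f := fun k => slope (P k) t s)
      ?_ (hband.mono fun k hk => hk s hs)
    simp only [slope_def_module]
    exact (h2.sub h1).const_smul _
  refine (isClosed_signBand _ _ _ _).mem_of_tendsto
    ((hasDerivAt_iff_tendsto_slope.1 hd).mono_left (nhdsGT_le_nhdsNE t)) ?_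
  filter_upwards [Ioo_mem_nhdsGT (lt_min (lt_add_of_pos_right t hδ) ht.2)] with s hs
  exact hslope s hs

/-- Linear systems with passive set-valued sign feedback and a locally integrable inhomogeneity
have global solutions. The solutions for the saturated signs form a Cauchy sequence, by passivity,
and their limit is a solution. -/
theorem exists_passive_signSet_solution [FiniteDimensional ℝ E] {φ : E →L[ℝ] (ι → ℝ)}
    (hφ : Function.Injective φ)
    (Λ : E →L[ℝ] E) {Ψ : (J → ℝ) →L[ℝ] E} {h : E →L[ℝ] (J → ℝ)} {k : J → ℝ} (hk : ∀ j, 0 ≤ k j)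
    (hpass : ∀ x σ, φ x ⬝ᵥ φ (Ψ σ) = -∑ j, k j * (h x j * σ j)) {b : ℝ → E}
    (hb : LocallyIntegrableOn b (Ici 0)) (x₀ : E) :
    ∃ X : ℝ → E, X 0 = x₀ ∧ (∀ T, 0 ≤ T → AbsolutelyContinuousOnInterval X 0 T) ∧
      ∀ᵐ t, 0 < t → ∃ σ ∈ signSet 0 (h (X t)), HasDerivAt X (Λ (X t) + b t + Ψ σ) t := by
  have := FiniteDimensional.complete ℝ E
  have hint : ∀ T, 0 ≤ T → IntervalIntegrable b volume 0 T := fun T hT =>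
    (intervalIntegrable_iff_integrableOn_Icc_of_le hT).2
      (hb.integrableOn_compact_subset Icc_subset_Ici_self isCompact_Icc)
  set β : ℝ → E := fun t => ∫ s in (0 : ℝ)..t, b s with hβ
  have hβac : ∀ T, 0 ≤ T → AbsolutelyContinuousOnInterval β 0 T := fun T hT =>
    (hint T hT).absolutelyContinuousOnInterval_primitive
  have hβcont : ∀ T, 0 ≤ T → ContinuousOn β (Icc 0 T) := fun T hT => by
    simpa [uIcc_of_le hT] using (hβac T hT).continuousOn
  have hpos : ∀ j : ℕ, (0 : ℝ) < j + 1 := fun j => by positivity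
  -- the approximate solution for the slope `j + 1` lives on the interval `[0, j]`
  choose P hP0 hP using fun j : ℕ => exists_saturated_solution Λ Ψ h x₀ (Nat.cast_nonneg j)
    (hpos j).le (hβcont j (Nat.cast_nonneg j))
  have hPT : ∀ {T : ℝ} {j : ℕ}, T ≤ j → ∀ t ∈ Icc 0 T, HasDerivWithinAt (P j)
      (Λ (P j t + β t) + Ψ fun i => saturation (j + 1) (h (P j t + β t) i)) (Icc 0 T) t :=
    fun hj t ht => (hP _ t (Icc_subset_Icc_right hj ht)).mono (Icc_subset_Icc_right hj)
  have hcauchy : ∀ T, UniformCauchySeqOn P atTop (Icc 0 T) := by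
    intro T
    obtain ⟨M, hM0, hM⟩ := exists_saturated_solution_dist_le hφ Λ hk hpass β T
    rw [Metric.uniformCauchySeqOn_iff]
    intro ε hε
    obtain ⟨j₀, hj₀⟩ := exists_nat_gt (2 * M / ε ^ 2)
    refine ⟨max j₀ ⌈T⌉₊, fun i hi j hj t ht => ?_⟩
    have h1 := hM _ _ _ _ (hpos i) (hpos j) ((hP0 i).trans (hP0 j).symm)
      (hPT (Nat.ceil_le.1 ((le_max_right _ _).trans hi)))
      (hPT (Nat.ceil_le.1 ((le_max_right _ _).trans hj))) t ht
    have h2 : ∀ i : ℕ, max j₀ ⌈T⌉₊ ≤ i → M * (1 / ((i : ℝ) + 1)) < ε ^ 2 / 2 := fun i hi => by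
      have h3 : (j₀ : ℝ) ≤ i := Nat.cast_le.2 ((le_max_left _ _).trans hi)
      rw [mul_one_div, div_lt_iff₀ (hpos i)]
      rw [div_lt_iff₀ (by positivity)] at hj₀
      nlinarith [sq_nonneg ε]
    rw [dist_eq_norm]
    refine lt_of_pow_lt_pow_left₀ 2 hε.le ?_
    have := h2 i hi
    have := h2 j hj
    linarith
  have hptw : ∀ t : ℝ, ∃ x, 0 ≤ t → Tendsto (fun j => P j t) atTop (𝓝 x) := fun t => by
    by_cases ht : 0 ≤ t
    · obtain ⟨x, hx⟩ := cauchySeq_tendsto_of_complete ((hcauchy t).cauchySeq ⟨ht, le_rfl⟩)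
      exact ⟨x, fun _ => hx⟩
    · exact ⟨0, fun h => absurd h ht⟩
  choose Q hQ using hptw
  have hunif : ∀ T, TendstoUniformlyOn P Q atTop (Icc 0 T) := fun T =>
    (hcauchy T).tendstoUniformlyOn_of_tendsto fun t ht => hQ t ht.1
  have hPev : ∀ T : ℝ, ∀ᶠ j : ℕ in atTop, ∀ t ∈ Icc 0 T, HasDerivWithinAt (P j)
      (Λ (P j t + β t) + Ψ fun i => saturation (j + 1) (h (P j t + β t) i)) (Icc 0 T) t :=
    fun T => (eventually_ge_atTop ⌈T⌉₊).mono fun j hj => hPT (Nat.ceil_le.1 hj)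
  -- the approximate solutions are uniformly Lipschitz, and so is their limit
  have hQac : ∀ T, 0 ≤ T → AbsolutelyContinuousOnInterval Q 0 T := by
    intro T hT
    have hQc : ContinuousOn Q (Icc 0 T) := (hunif T).continuousOn
      ((hPev T).mono fun j hj t ht => (hj t ht).continuousWithinAt).frequently
    obtain ⟨B, hB⟩ := isCompact_Icc.exists_bound_of_continuousOn (hQc.add (hβcont T hT))
    have hev : ∀ᶠ j : ℕ in atTop, ∀ s ∈ Icc 0 T, ∀ t ∈ Icc 0 T,
        ‖P j t - P j s‖ ≤ (‖Λ‖ * (B + 1) + ‖Ψ‖) * ‖t - s‖ := by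
      filter_upwards [hPev T, Metric.tendstoUniformlyOn_iff.1 (hunif T) 1 one_pos] with j h1 h2
      intro s hs t ht
      refine (convex_Icc 0 T).norm_image_sub_le_of_norm_hasDerivWithin_le h1 (fun τ hτ => ?_) hs ht
      refine (norm_add_le _ _).trans (add_le_add ((Λ.le_opNorm _).trans ?_)
        ((Ψ.le_opNorm _).trans ?_))
      · have h3 := (h2 τ hτ).le
        rw [dist_comm, dist_eq_norm] at h3
        refine mul_le_mul_of_nonneg_left ?_ (norm_nonneg _)
        calc ‖P j τ + β τ‖ = ‖(Q τ + β τ) + (P j τ - Q τ)‖ := by congr 1; abel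
          _ ≤ B + 1 := (norm_add_le _ _).trans (add_le_add (hB τ hτ) h3)
      · refine mul_le_of_le_one_right (norm_nonneg _)
          ((pi_norm_le_iff_of_nonneg zero_le_one).2 fun i => ?_)
        exact (saturation_mem_signSet (hpos j) (h (P j τ + β τ)) i).1
    have hL : LipschitzOnWith (‖Λ‖ * (B + 1) + ‖Ψ‖).toNNReal Q (Icc 0 T) := by
      refine LipschitzOnWith.of_dist_le_mul fun t ht s hs => ?_
      have h4 : ‖Q t - Q s‖ ≤ (‖Λ‖ * (B + 1) + ‖Ψ‖) * ‖t - s‖ :=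
        le_of_tendsto (((hQ t ht.1).sub (hQ s hs.1)).norm) (hev.mono fun j hj => hj s hs t ht)
      rw [dist_eq_norm, dist_eq_norm]
      exact h4.trans (mul_le_mul_of_nonneg_right (Real.le_coe_toNNReal _) (norm_nonneg _))
    rw [← uIcc_of_le hT] at hL
    exact hL.absolutelyContinuousOnInterval
  have hQ0 : Q 0 = x₀ := tendsto_nhds_unique (hQ 0 le_rfl) (by simp [hP0])
  refine ⟨fun t => Q t + β t, by simp [hQ0, hβ], fun T hT => (hQac T hT).fun_add (hβac T hT), ?_⟩
  have hae : ∀ᵐ t, ∀ N : ℕ, t ∈ Ioo 0 (N : ℝ) →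
      ∃ σ ∈ signSet 0 (h (Q t + β t)),
        HasDerivAt (fun t => Q t + β t) (Λ (Q t + β t) + b t + Ψ σ) t := by
    rw [ae_all_iff]
    intro N
    have hN : (0 : ℝ) ≤ N := Nat.cast_nonneg N
    filter_upwards [(hQac N hN).ae_differentiableAt_of_finiteDimensional,
      (hint N hN).ae_hasDerivAt_integral] with t h1 h2 hmem
    have hmem' : t ∈ uIcc 0 (N : ℝ) := by
      rw [uIcc_of_le hN]; exact Ioo_subset_Icc_self hmem
    have hd := (h1 hmem').hasDerivAt
    obtain ⟨σ, hσ, hσ'⟩ := exists_signSet_of_tendsto_saturated (hβcont N hN) (hPev N) (hunif N)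
      hmem hd
    refine ⟨σ, hσ, ?_⟩
    have h3 := hd.add (h2 hmem' 0 left_mem_uIcc)
    rw [hσ'] at h3
    rw [add_right_comm]
    exact h3
  filter_upwards [hae] with t ht h0
  obtain ⟨N, hN⟩ := exists_nat_gt t
  exact ht N ⟨h0, hN⟩

end Inclusion

/-! ### Exponential decay for Hurwitz matrices -/

section Hurwitz

open scoped Matrix.Norms.Operator

variable {o : Type*} [Fintype o] [DecidableEq o]

theorem Matrix.exp_mulVec_of_mulVec_eq_smul {M : Matrix o o ℂ} {w : o → ℂ} {lam : ℂ}
    (h : M *ᵥ w = lam • w) : NormedSpace.exp M *ᵥ w = Complex.exp lam • w := by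
  have hpow : ∀ k : ℕ, (M ^ k) *ᵥ w = lam ^ k • w := fun k => by
    induction k with
    | zero => simp
    | succ k ih => rw [pow_succ, ← Matrix.mulVec_mulVec, h, Matrix.mulVec_smul, ih, smul_smul,
        pow_succ, mul_comm]
  have h1 := (NormedSpace.exp_series_hasSum_exp' (𝕂 := ℂ) M).map
    (((Matrix.mulVecBilin ℂ ℂ).flip w).toAddMonoidHom)
    (LinearMap.continuous_of_finiteDimensional ((Matrix.mulVecBilin ℂ ℂ).flip w))
  have h2 := (NormedSpace.exp_series_hasSum_exp' (𝕂 := ℂ) lam).smul_const w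
  rw [← Complex.exp_eq_exp_ℂ] at h2
  refine h1.unique ?_
  convert! h2 using 2 with k
  simp [Matrix.mulVecBilin, hpow, smul_smul]

/-- The eigenvalues of the exponential of a matrix are exponentials of eigenvalues. -/
theorem Matrix.exists_exp_eq_of_mem_spectrum_exp {M : Matrix o o ℂ} {μ : ℂ}
    (hμ : μ ∈ spectrum ℂ (NormedSpace.exp M)) : ∃ lam ∈ spectrum ℂ M, Complex.exp lam = μ := by
  rw [← Matrix.spectrum_toLin', ← Module.End.hasEigenvalue_iff_mem_spectrum] at hμ
  have hcomm : Commute (Matrix.toLin' (NormedSpace.exp M)) (Matrix.toLin' M) := by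
    have : Commute (NormedSpace.exp M) M := (Commute.refl M).exp_left
    rw [Commute, SemiconjBy, Module.End.mul_eq_comp, Module.End.mul_eq_comp,
      ← Matrix.toLin'_mul, ← Matrix.toLin'_mul, this.eq]
  have hmap := Module.End.mapsTo_genEigenspace_of_comm hcomm μ 1
  have : Nontrivial (Module.End.eigenspace (Matrix.toLin' (NormedSpace.exp M)) μ) :=
    Submodule.nontrivial_iff_ne_bot.2 hμ
  obtain ⟨lam, hlam⟩ := Module.End.exists_eigenvalue ((Matrix.toLin' M).restrict hmap)
  obtain ⟨w, hw⟩ := hlam.exists_hasEigenvector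
  have hw0 : (w : o → ℂ) ≠ 0 := fun h => hw.2 (Subtype.ext h)
  have h1 : M *ᵥ (w : o → ℂ) = lam • (w : o → ℂ) := congrArg Subtype.val hw.apply_eq_smul
  have h2 : NormedSpace.exp M *ᵥ (w : o → ℂ) = μ • (w : o → ℂ) :=
    Module.End.mem_eigenspace_iff.1 w.2
  refine ⟨lam, ?_, ?_⟩
  · rw [← Matrix.spectrum_toLin', ← Module.End.hasEigenvalue_iff_mem_spectrum]
    exact Module.End.hasEigenvalue_of_hasEigenvector
      ⟨Module.End.mem_eigenspace_iff.2 (by simpa using h1), hw0⟩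
  · rw [Matrix.exp_mulVec_of_mulVec_eq_smul h1] at h2
    exact smul_left_injective ℂ hw0 h2

theorem tendsto_norm_pow_of_spectralRadius_lt_one {A : Type*} [NormedRing A] [NormedAlgebra ℂ A]
    [CompleteSpace A] {a : A} (ha : spectralRadius ℂ a < 1) :
    Tendsto (fun k : ℕ => ‖a ^ k‖) atTop (𝓝 0) := by
  obtain ⟨r, hr1, hr2⟩ := ENNReal.lt_iff_exists_nnreal_btwn.1 ha
  have hr : (r : ℝ) < 1 := by exact_mod_cast hr2
  refine squeeze_zero' (Eventually.of_forall fun k => norm_nonneg _) ?_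
    (tendsto_pow_atTop_nhds_zero_of_lt_one r.coe_nonneg hr)
  filter_upwards [(spectrum.pow_nnnorm_pow_one_div_tendsto_nhds_spectralRadius a).eventually_lt_const
    hr1, eventually_gt_atTop 0] with k hk hk0
  have hk0' : (0 : ℝ) < k := Nat.cast_pos.2 hk0
  rw [one_div, ENNReal.rpow_inv_lt_iff hk0', ENNReal.rpow_natCast] at hk
  exact_mod_cast hk.le

/-- The exponential `exp (t M)` of a Hurwitz matrix `M` tends to zero. -/
theorem IsHurwitz.tendsto_exp {M : Matrix o o ℝ} (hM : IsHurwitz M) :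
    Tendsto (fun t : ℝ => ‖NormedSpace.exp (t • M.map (algebraMap ℝ ℂ))‖) atTop (𝓝 0) := by
  set Mc := M.map (algebraMap ℝ ℂ) with hMc
  have hcont : Continuous fun t : ℝ => NormedSpace.exp (t • Mc) :=
    (differentiable_exp_smul_const ℝ Mc).continuous
  rcases isEmpty_or_nonempty o with ho | ho
  · have : ∀ t : ℝ, ‖NormedSpace.exp (t • Mc)‖ = 0 := fun t => by
      rw [Subsingleton.elim (NormedSpace.exp (t • Mc)) 0, norm_zero]
    simp only [this]
    exact tendsto_const_nhds
  have hrad : spectralRadius ℂ (NormedSpace.exp Mc) < 1 := by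
    have := spectrum.spectralRadius_lt_of_forall_lt (NormedSpace.exp Mc) (r := 1) (fun z hz => by
      obtain ⟨lam, hlam, rfl⟩ := Matrix.exists_exp_eq_of_mem_spectrum_exp hz
      rw [← NNReal.coe_lt_coe, coe_nnnorm, Complex.norm_exp]
      exact (Real.exp_lt_one_iff.2 (hM lam hlam)))
    simpa using this
  obtain ⟨B, hB⟩ := (isCompact_Icc (a := (0 : ℝ)) (b := 1)).exists_bound_of_continuousOn
    hcont.continuousOn
  have h1 := ((tendsto_norm_pow_of_spectralRadius_lt_one hrad).comp
    (tendsto_nat_floor_atTop (α := ℝ))).mul_const B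
  rw [zero_mul] at h1
  refine squeeze_zero' (Eventually.of_forall fun t => norm_nonneg _) ?_ h1
  filter_upwards [eventually_ge_atTop 0] with t ht
  have hsplit : t • Mc = ⌊t⌋₊ • Mc + (t - ⌊t⌋₊) • Mc := by
    rw [← Nat.cast_smul_eq_nsmul ℝ, ← add_smul]
    congr 1
    ring
  have hcomm : Commute (⌊t⌋₊ • Mc) ((t - ⌊t⌋₊) • Mc) :=
    ((Commute.refl Mc).smul_left _).smul_right _
  rw [hsplit, Matrix.exp_add_of_commute _ _ hcomm, Matrix.exp_nsmul]
  refine (norm_mul_le _ _).trans (mul_le_mul_of_nonneg_left (hB _ ⟨?_, ?_⟩) (norm_nonneg _))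
  · exact sub_nonneg.2 (Nat.floor_le ht)
  · have := Nat.lt_floor_add_one t
    linarith

/-- The absolutely continuous solutions of `ẏ = M y` with a Hurwitz matrix `M` tend to zero, and
they are bounded in terms of the initial value. -/
theorem IsHurwitz.exists_bound {M : Matrix o o ℝ} (hM : IsHurwitz M) :
    ∃ c, 0 ≤ c ∧ ∀ y : ℝ → o → ℝ, (∀ T, 0 ≤ T → AbsolutelyContinuousOnInterval y 0 T) →
      (∀ᵐ t, 0 < t → HasDerivAt y (M *ᵥ y t) t) →
      (∀ t, 0 ≤ t → ‖y t‖ ≤ c * ‖y 0‖) ∧ Tendsto y atTop (𝓝 0) := by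
  set Mc := M.map (algebraMap ℝ ℂ) with hMc
  have hcont : Continuous fun t : ℝ => NormedSpace.exp (t • Mc) :=
    (differentiable_exp_smul_const ℝ Mc).continuous
  obtain ⟨T₀, hT₀⟩ := eventually_atTop.1 (hM.tendsto_exp.eventually_le_const one_pos)
  obtain ⟨B, hB⟩ := (isCompact_Icc (a := (0 : ℝ)) (b := T₀)).exists_bound_of_continuousOn
    hcont.continuousOn
  have hbound : ∀ t : ℝ, 0 ≤ t → ‖NormedSpace.exp (t • Mc)‖ ≤ max B 1 := fun t ht => by
    rcases le_total t T₀ with h | h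
    · exact (hB t ⟨ht, h⟩).trans (le_max_left _ _)
    · exact (hT₀ t h).trans (le_max_right _ _)
  refine ⟨max B 1, zero_le_one.trans (le_max_right _ _), fun y hy hy' => ?_⟩
  set y₀ : o → ℂ := fun i => (y 0 i : ℂ) with hy₀
  set Y : ℝ → o → ℝ := fun t i => ((NormedSpace.exp (t • Mc) *ᵥ y₀) i).re with hY
  have hYd : ∀ t, HasDerivAt Y (M *ᵥ Y t) t := fun t => by
    refine hasDerivAt_pi.2 fun i => ?_
    have h1 := hasDerivAt_exp_smul_const' (𝕂 := ℝ) Mc t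
    have h2 : HasDerivAt (fun t : ℝ => (NormedSpace.exp (t • Mc) *ᵥ y₀) i)
        (((Mc * NormedSpace.exp (t • Mc)) *ᵥ y₀) i) t := by
      simp only [Matrix.mulVec, dotProduct]
      exact HasDerivAt.fun_sum fun j _ =>
        ((hasDerivAt_pi.1 (hasDerivAt_pi.1 h1 i) j)).mul_const _
    have h3 := Complex.reCLM.hasFDerivAt.comp_hasDerivAt t h2
    refine h3.congr_deriv ?_
    rw [← Matrix.mulVec_mulVec]
    simp [Matrix.mulVec, dotProduct, hMc, hY]
  have hYac : ∀ T, AbsolutelyContinuousOnInterval Y 0 T := fun T => by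
    refine ContDiffOn.absolutelyContinuousOnInterval (ContDiff.contDiffOn ?_)
    have hYc : Continuous Y := continuous_iff_continuousAt.2 fun t => (hYd t).continuousAt
    refine contDiff_one_iff_deriv.2 ⟨fun t => (hYd t).differentiableAt, ?_⟩
    rw [show deriv Y = fun t => M *ᵥ Y t from funext fun t => (hYd t).deriv]
    exact Continuous.matrix_mulVec continuous_const hYc
  have hy0 : y 0 = Y 0 := by
    funext i
    simp [hY, hy₀]
  -- uniqueness for linear systems is the case of a feedback through no sign at all
  have heq : ∀ t, 0 ≤ t → y t = Y t := fun t ht => by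
    refine eq_of_passive_signSet (J := Empty) (ι := o) (φ := ContinuousLinearMap.id ℝ (o → ℝ))
      (Λ := (Matrix.mulVecLin M).toContinuousLinearMap) (Ψ := 0) (h := 0) (k := 0) (b := 0)
      Function.injective_id (fun j => le_rfl) (fun x σ => by simp) (hy t ht) (hYac t) ?_
      (Eventually.of_forall fun s _ => ⟨0, fun j => j.elim, by simpa using hYd s⟩) ht hy0
    filter_upwards [hy'] with s hs hmem
    exact ⟨0, fun j => j.elim, by simpa using hs hmem.1⟩
  have hle : ∀ t, 0 ≤ t → ‖y t‖ ≤ ‖NormedSpace.exp (t • Mc)‖ * ‖y 0‖ := fun t ht => by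
    rw [heq t ht]
    have h1 := Matrix.linfty_opNorm_mulVec (NormedSpace.exp (t • Mc)) y₀
    have h2 : ‖y₀‖ = ‖y 0‖ := by simp [hy₀, Pi.norm_def]
    rw [h2] at h1
    refine ((pi_norm_le_iff_of_nonneg (norm_nonneg _)).2 fun i => ?_).trans h1
    exact (Complex.abs_re_le_norm _).trans (norm_le_pi_norm _ i)
  refine ⟨fun t ht => (hle t ht).trans (mul_le_mul_of_nonneg_right (hbound t ht) (norm_nonneg _)),
    ?_⟩
  have h1 := hM.tendsto_exp.mul_const ‖y 0‖
  rw [zero_mul] at h1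
  exact squeeze_zero_norm' ((eventually_ge_atTop 0).mono hle) h1

end Hurwitz

/-! ### The disagreement of a connected network -/

section Network

set_option linter.unusedSectionVars false

variable {V o : Type*} [Fintype V] [Fintype o]

theorem SimpleGraph.sum_neighborFinset_comm [DecidableEq V] (G : SimpleGraph V)
    [DecidableRel G.Adj] (f : V → V → ℝ) :
    ∑ i, ∑ j ∈ G.neighborFinset i, f i j = ∑ i, ∑ j ∈ G.neighborFinset i, f j i := by
  have h : ∀ f : V → V → ℝ, ∑ i, ∑ j ∈ G.neighborFinset i, f i j
      = ∑ i, ∑ j, if G.Adj i j then f i j else 0 := fun f => by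
    refine Finset.sum_congr rfl fun i _ => ?_
    rw [SimpleGraph.neighborFinset_eq_filter, Finset.sum_filter]
  rw [h, h, Finset.sum_comm]
  simp only [G.adj_comm]

theorem SimpleGraph.sum_neighborFinset_sub_eq_zero [DecidableEq V] (G : SimpleGraph V)
    [DecidableRel G.Adj] (d : V → ℝ) : ∑ i, ∑ j ∈ G.neighborFinset i, (d j - d i) = 0 := by
  have h := G.sum_neighborFinset_comm fun i j => d j - d i
  have h2 : ∑ i, ∑ j ∈ G.neighborFinset i, (d i - d j)
      = -∑ i, ∑ j ∈ G.neighborFinset i, (d j - d i) := by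
    simp only [← Finset.sum_neg_distrib, neg_sub]
  linarith

theorem SimpleGraph.sum_mul_sum_neighborFinset_sub [DecidableEq V] (G : SimpleGraph V)
    [DecidableRel G.Adj] (d : V → ℝ) :
    2 * ∑ i, d i * ∑ j ∈ G.neighborFinset i, (d j - d i)
      = -∑ i, ∑ j ∈ G.neighborFinset i, (d j - d i) ^ 2 := by
  have h := G.sum_neighborFinset_comm fun i j => d i * (d j - d i)
  rw [two_mul]
  simp only [Finset.mul_sum]
  nth_rewrite 2 [h]
  simp only [← Finset.sum_add_distrib, ← Finset.sum_neg_distrib]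
  exact Finset.sum_congr rfl fun i _ => Finset.sum_congr rfl fun j _ => by ring

/-- The Poincaré inequality on a connected graph. Along a path between two vertices, the values
differ by at most the length of the path times the largest difference across an edge. -/
theorem SimpleGraph.Connected.exists_sum_sq_le [DecidableEq V] {G : SimpleGraph V}
    [DecidableRel G.Adj] (hG : G.Connected) :
    ∃ c, 0 < c ∧ ∀ d : V → ℝ, ∑ i, d i = 0 →
      ∑ i, d i ^ 2 ≤ c * ∑ i, ∑ j ∈ G.neighborFinset i, (d j - d i) ^ 2 := by
  have := hG.nonempty
  have hN : (0 : ℝ) < Fintype.card V := Nat.cast_pos.2 Fintype.card_pos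
  set ℓ : ℝ := ∑ i, ∑ j, (G.dist i j : ℝ) with hℓ
  have hℓ0 : 0 ≤ ℓ := by positivity
  refine ⟨Fintype.card V * ℓ ^ 2 + 1, by positivity, fun d hd => ?_⟩
  set Q : ℝ := ∑ i, ∑ j ∈ G.neighborFinset i, (d j - d i) ^ 2 with hQ
  have hQ0 : 0 ≤ Q := by positivity
  have hedge : ∀ i j, G.Adj i j → |d j - d i| ≤ √Q := fun i j hij => by
    refine Real.abs_le_sqrt ?_
    refine (Finset.single_le_sum (f := fun j => (d j - d i) ^ 2) (fun _ _ => sq_nonneg _)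
      ((G.mem_neighborFinset i j).2 hij)).trans ?_
    exact Finset.single_le_sum (f := fun i => ∑ j ∈ G.neighborFinset i, (d j - d i) ^ 2)
      (fun _ _ => by positivity) (Finset.mem_univ i)
  have hwalk : ∀ {i j : V} (p : G.Walk i j), |d j - d i| ≤ p.length * √Q := by
    intro i j p
    induction p with
    | nil => simp
    | @cons i k j h p ih =>
      have h1 := abs_sub_le (d j) (d k) (d i)
      have h2 := hedge i k h
      rw [SimpleGraph.Walk.length_cons, Nat.cast_add, Nat.cast_one]
      linarith
  have hdiff : ∀ i j, |d j - d i| ≤ ℓ * √Q := fun i j => by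
    obtain ⟨p, hp⟩ := hG.exists_walk_length_eq_dist i j
    refine (hwalk p).trans (mul_le_mul_of_nonneg_right ?_ (Real.sqrt_nonneg _))
    rw [hp]
    refine (Finset.single_le_sum (f := fun j => (G.dist i j : ℝ)) (fun _ _ => by positivity)
      (Finset.mem_univ j)).trans ?_
    exact Finset.single_le_sum (f := fun i => ∑ j, (G.dist i j : ℝ)) (fun _ _ => by positivity)
      (Finset.mem_univ i)
  have hpt : ∀ i, d i ^ 2 ≤ ℓ ^ 2 * Q := fun i => by
    have h1 : (Fintype.card V : ℝ) * d i = ∑ j, (d i - d j) := by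
      rw [Finset.sum_sub_distrib, hd, sub_zero, Finset.sum_const, Finset.card_univ, nsmul_eq_mul]
    have h2 : (Fintype.card V : ℝ) * |d i| ≤ Fintype.card V * (ℓ * √Q) := by
      rw [← abs_of_pos hN, ← abs_mul, h1, abs_of_pos hN]
      refine (Finset.abs_sum_le_sum_abs _ _).trans ?_
      rw [← nsmul_eq_mul, ← Finset.card_univ]
      exact Finset.sum_le_card_nsmul _ _ _ fun j _ => hdiff j i
    have h3 := le_of_mul_le_mul_left h2 hN
    calc d i ^ 2 = |d i| ^ 2 := (sq_abs _).symm
      _ ≤ (ℓ * √Q) ^ 2 := by gcongr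
      _ = ℓ ^ 2 * Q := by rw [mul_pow, Real.sq_sqrt hQ0]
  calc ∑ i, d i ^ 2 ≤ ∑ _i : V, ℓ ^ 2 * Q := Finset.sum_le_sum fun i _ => hpt i
    _ = Fintype.card V * ℓ ^ 2 * Q := by
      rw [Finset.sum_const, Finset.card_univ, nsmul_eq_mul, mul_assoc]
    _ ≤ _ := by nlinarith

/-- The average over the agents. -/
def agentMean (y : V → o → ℝ) (l : o) : ℝ := (∑ i, y i l) / Fintype.card V

/-- The squared distance to consensus. -/
def disagreement (y : V → o → ℝ) : ℝ := ∑ l, ∑ i, (y i l - agentMean y l) ^ 2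

theorem abs_sub_agentMean_le (y : V → o → ℝ) (i : V) (l : o) :
    |y i l - agentMean y l| ≤ √(disagreement y) := by
  refine Real.abs_le_sqrt ?_
  refine (Finset.single_le_sum (f := fun i => (y i l - agentMean y l) ^ 2)
    (fun _ _ => sq_nonneg _) (Finset.mem_univ i)).trans ?_
  exact Finset.single_le_sum (f := fun l => ∑ i, (y i l - agentMean y l) ^ 2)
    (fun _ _ => by positivity) (Finset.mem_univ l)

theorem card_mul_agentMean [Nonempty V] (y : V → o → ℝ) (l : o) :
    Fintype.card V * agentMean y l = ∑ i, y i l :=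
  mul_div_cancel₀ _ (Nat.cast_ne_zero.2 Fintype.card_ne_zero)

theorem sum_sub_agentMean [Nonempty V] (y : V → o → ℝ) (l : o) :
    ∑ i, (y i l - agentMean y l) = 0 := by
  rw [Finset.sum_sub_distrib, ← card_mul_agentMean, Finset.sum_const, Finset.card_univ,
    nsmul_eq_mul, sub_self]

theorem abs_agentMean_le [Nonempty V] {y : V → o → ℝ} {D : ℝ} {l : o} (hy : ∀ i, |y i l| ≤ D) :
    |agentMean y l| ≤ D := by
  have hN : (0 : ℝ) < Fintype.card V := Nat.cast_pos.2 Fintype.card_pos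
  rw [agentMean, abs_div, abs_of_pos hN, div_le_iff₀ hN]
  refine (Finset.abs_sum_le_sum_abs _ _).trans ?_
  rw [mul_comm, ← nsmul_eq_mul, ← Finset.card_univ]
  exact Finset.sum_le_card_nsmul _ _ _ fun i _ => hy i

theorem disagreement_le [Nonempty V] {y : V → o → ℝ} {D : ℝ} (hy : ∀ i l, |y i l| ≤ D) :
    disagreement y ≤ Fintype.card o * (Fintype.card V * (2 * D) ^ 2) := by
  rw [disagreement, ← nsmul_eq_mul, ← nsmul_eq_mul, ← Finset.card_univ, ← Finset.card_univ]
  refine Finset.sum_le_card_nsmul _ _ _ fun l _ => Finset.sum_le_card_nsmul _ _ _ fun i _ => ?_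
  rw [← sq_abs]
  have h1 := abs_sub (y i l) (agentMean y l)
  have h2 := abs_agentMean_le fun i => hy i l
  have h3 := hy i l
  gcongr
  linarith

variable [DecidableEq V]

/-- The coupled dynamics of the agents, where `τ` are the inputs from their own measurements. -/
def networkField (G : SimpleGraph V) [DecidableRel G.Adj] (M : (o → ℝ) →L[ℝ] (o → ℝ)) (κ γ : ℝ)
    (τ y : V → o → ℝ) (i : V) (l : o) : ℝ :=
  M (y i) l + κ * τ i l + κ * γ * ∑ j ∈ G.neighborFinset i, (y j l - y i l)

theorem agentMean_networkField [Nonempty V] (G : SimpleGraph V) [DecidableRel G.Adj]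
    (M : (o → ℝ) →L[ℝ] (o → ℝ)) (κ γ : ℝ) (τ y : V → o → ℝ) (l : o) :
    agentMean (networkField G M κ γ τ y) l = M (agentMean y) l + κ * agentMean τ l := by
  have h1 : M (agentMean y) l = (∑ i, M (y i) l) / Fintype.card V := by
    have : agentMean y = (Fintype.card V : ℝ)⁻¹ • ∑ i, y i := by
      funext l
      simp [agentMean, div_eq_inv_mul]
    rw [this, map_smul, map_sum]
    simp [div_eq_inv_mul]
  rw [h1]
  simp only [agentMean, networkField, Finset.sum_add_distrib, ← Finset.mul_sum,
    G.sum_neighborFinset_sub_eq_zero fun i => y i l]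
  ring

/-- For a strong coupling, the disagreement decreases while it is not small. The coupling gain
needed does not depend on `κ`, because `κ` multiplies both the inputs and the coupling. -/
theorem SimpleGraph.Connected.exists_disagreement_deriv_le {G : SimpleGraph V}
    [DecidableRel G.Adj] (hG : G.Connected) (M : (o → ℝ) →L[ℝ] (o → ℝ)) {ρ : ℝ} (hρ : 0 < ρ) :
    ∃ γs : ℝ, ∀ κ γ : ℝ, 1 ≤ κ → γs < γ → ∀ τ y : V → o → ℝ, (∀ i l, |τ i l| ≤ 1) →
      ρ ^ 2 ≤ disagreement y →
      ∑ l, ∑ i, 2 * ((y i l - agentMean y l) * (networkField G M κ γ τ y i l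
        - agentMean (networkField G M κ γ τ y) l)) ≤ -ρ ^ 2 := by
  have := hG.nonempty
  obtain ⟨c, hc, hpoinc⟩ := hG.exists_sum_sq_le
  set n : ℝ := Fintype.card o * Fintype.card V with hn
  have hn0 : 0 ≤ n := by positivity
  refine ⟨c * (2 * n * ‖M‖ + 2 * n / ρ + 1), fun κ γ hκ hγ τ y hτ hy => ?_⟩
  set W := disagreement y with hW
  have hW0 : 0 < W := (by positivity : 0 < ρ ^ 2).trans_le hy
  set S := √W with hS
  have hS0 : 0 < S := Real.sqrt_pos.2 hW0
  have hSS : S ^ 2 = W := Real.sq_sqrt hW0.le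
  have hSρ : ρ ≤ S := Real.le_sqrt_of_sq_le hy
  set δ : V → o → ℝ := fun i l => y i l - agentMean y l with hδ
  have hδS : ∀ i l, |δ i l| ≤ S := abs_sub_agentMean_le y
  have hδ0 : ∀ l, ∑ i, δ i l = 0 := sum_sub_agentMean y
  have hsum : ∀ f : V → o → ℝ, (∀ i l, f i l ≤ ‖M‖ * S ^ 2) → ∑ l, ∑ i, f i l ≤ n * (‖M‖ * S ^ 2) :=
    fun f hf => by
      rw [hn, mul_assoc, ← nsmul_eq_mul, ← nsmul_eq_mul, ← Finset.card_univ, ← Finset.card_univ]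
      exact Finset.sum_le_card_nsmul _ _ _ fun l _ =>
        Finset.sum_le_card_nsmul _ _ _ fun i _ => hf i l
  have hM : ∑ l, ∑ i, δ i l * M (δ i) l ≤ n * (‖M‖ * S ^ 2) := by
    refine hsum _ fun i l => (le_abs_self _).trans ?_
    rw [abs_mul]
    have h1 : ‖δ i‖ ≤ S := (pi_norm_le_iff_of_nonneg hS0.le).2 fun l => hδS i l
    have h2 : |M (δ i) l| ≤ ‖M‖ * S :=
      (norm_le_pi_norm _ l).trans ((M.le_opNorm _).trans (by gcongr))
    calc |δ i l| * |M (δ i) l| ≤ S * (‖M‖ * S) := by gcongr; exact hδS i l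
      _ = ‖M‖ * S ^ 2 := by ring
  have hT : ∑ l, ∑ i, δ i l * τ i l ≤ n * S := by
    rw [hn, mul_assoc, ← nsmul_eq_mul, ← nsmul_eq_mul, ← Finset.card_univ, ← Finset.card_univ]
    refine Finset.sum_le_card_nsmul _ _ _ fun l _ =>
      Finset.sum_le_card_nsmul _ _ _ fun i _ => (le_abs_self _).trans ?_
    rw [abs_mul]
    exact (mul_le_of_le_one_right (abs_nonneg _) (hτ i l)).trans (hδS i l)
  have hT' : n * S ≤ n / ρ * W := by
    rw [← hSS, div_mul_eq_mul_div, le_div_iff₀ hρ]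
    nlinarith [mul_nonneg hn0 hS0.le]
  have hL : ∑ l, 2 * ∑ i, δ i l * ∑ j ∈ G.neighborFinset i, (δ j l - δ i l) ≤ -(W / c) := by
    have h1 : W = ∑ l, ∑ i, δ i l ^ 2 := rfl
    rw [h1, Finset.sum_div, ← Finset.sum_neg_distrib]
    refine Finset.sum_le_sum fun l _ => ?_
    rw [G.sum_mul_sum_neighborFinset_sub fun i => δ i l]
    refine neg_le_neg ((div_le_iff₀ hc).2 ?_)
    rw [mul_comm]
    exact hpoinc (fun i => δ i l) (hδ0 l)
  -- the average of the field and the field at the average do not contribute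
  have hsplit : ∀ l, ∑ i, 2 * (δ i l * (networkField G M κ γ τ y i l
        - agentMean (networkField G M κ γ τ y) l))
      = 2 * ∑ i, δ i l * M (δ i) l + 2 * κ * ∑ i, δ i l * τ i l
        + κ * γ * (2 * ∑ i, δ i l * ∑ j ∈ G.neighborFinset i, (δ j l - δ i l)) := by
    intro l
    have h1 : ∀ i, δ i l * (networkField G M κ γ τ y i l
        - agentMean (networkField G M κ γ τ y) l)
        = δ i l * M (δ i) l + κ * (δ i l * τ i l)
          + κ * γ * (δ i l * ∑ j ∈ G.neighborFinset i, (δ j l - δ i l))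
          + δ i l * (M (agentMean y) l - agentMean (networkField G M κ γ τ y) l) := fun i => by
      have h2 : M (y i) l = M (δ i) l + M (agentMean y) l := by
        have h3 : y i = δ i + agentMean y := funext fun l => by simp [hδ]
        rw [← Pi.add_apply, ← map_add, ← h3]
      simp only [networkField, h2, hδ, sub_sub_sub_cancel_right]
      ring
    rw [← Finset.mul_sum, Finset.sum_congr rfl fun i _ => h1 i, Finset.sum_add_distrib,
      Finset.sum_add_distrib, Finset.sum_add_distrib, ← Finset.sum_mul, hδ0, zero_mul,
      ← Finset.mul_sum, ← Finset.mul_sum]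
    ring
  rw [Finset.sum_congr rfl fun l _ => hsplit l, Finset.sum_add_distrib, Finset.sum_add_distrib,
    ← Finset.mul_sum, ← Finset.mul_sum, ← Finset.mul_sum]
  have hγ' : 2 * n * ‖M‖ + 2 * n / ρ + 1 ≤ γ / c := by
    rw [le_div_iff₀ hc]; linarith
  have hγ0 : 0 ≤ γ := by
    have : 0 ≤ c * (2 * n * ‖M‖ + 2 * n / ρ + 1) := by positivity
    linarith
  have hκ0 : 0 ≤ κ := by linarith
  have e1 : κ * γ * ∑ l, 2 * ∑ i, δ i l * ∑ j ∈ G.neighborFinset i, (δ j l - δ i l)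
      ≤ κ * γ * (-(W / c)) := mul_le_mul_of_nonneg_left hL (by positivity)
  have e2 : κ * γ * (-(W / c)) ≤ -(κ * W * (2 * n * ‖M‖ + 2 * n / ρ + 1)) := by
    have := mul_le_mul_of_nonneg_left hγ' (by positivity : 0 ≤ κ * W)
    calc κ * γ * (-(W / c)) = -(κ * W * (γ / c)) := by ring
      _ ≤ _ := by linarith
  have e3 : 2 * κ * ∑ l, ∑ i, δ i l * τ i l ≤ 2 * κ * (n / ρ * W) :=
    mul_le_mul_of_nonneg_left (hT.trans hT') (by positivity)
  rw [hSS] at hM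
  have e4 : 2 * (n * (‖M‖ * W)) ≤ κ * (2 * (n * (‖M‖ * W))) :=
    le_mul_of_one_le_left (by positivity) hκ
  have e5 : W ≤ κ * W := le_mul_of_one_le_left hW0.le hκ
  have e6 : κ * W * (2 * n * ‖M‖ + 2 * n / ρ + 1)
      = κ * (2 * (n * (‖M‖ * W))) + 2 * κ * (n / ρ * W) + κ * W := by ring
  linarith

end Network

/-! ### Median-like consensus under a majority of good measurements -/

section Consensus

set_option linter.unusedSectionVars false

variable {V o : Type*} [Fintype V] [Fintype o] [DecidableEq V]

theorem agentMean_hasDerivAt {y : ℝ → V → o → ℝ} {r : V → o → ℝ} {t : ℝ} {l : o}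
    (h : ∀ i, HasDerivAt (fun t => y t i l) (r i l) t) :
    HasDerivAt (fun t => agentMean (y t) l) (agentMean r l) t :=
  (HasDerivAt.fun_sum fun i _ => h i).div_const _

theorem AbsolutelyContinuousOnInterval.agentMean {y : ℝ → V → o → ℝ} {a b : ℝ} {l : o}
    (h : ∀ i, AbsolutelyContinuousOnInterval (fun t => y t i l) a b) :
    AbsolutelyContinuousOnInterval (fun t => agentMean (y t) l) a b := by
  have := (finset_sum Finset.univ fun i _ => h i).const_mul (Fintype.card V : ℝ)⁻¹
  simpa only [_root_.agentMean, div_eq_inv_mul] using this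

theorem disagreement_hasDerivAt {y : ℝ → V → o → ℝ} {r : V → o → ℝ} {t : ℝ}
    (h : ∀ i l, HasDerivAt (fun t => y t i l) (r i l) t) :
    HasDerivAt (fun t => disagreement (y t))
      (∑ l, ∑ i, 2 * ((y t i l - agentMean (y t) l) * (r i l - agentMean r l))) t := by
  refine HasDerivAt.fun_sum fun l _ => HasDerivAt.fun_sum fun i _ => ?_
  refine (((h i l).sub (agentMean_hasDerivAt fun i => h i l)).pow 2).congr_deriv ?_
  simp only [Pi.sub_apply]
  ring

theorem AbsolutelyContinuousOnInterval.disagreement {y : ℝ → V → o → ℝ} {a b : ℝ}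
    (h : ∀ i l, AbsolutelyContinuousOnInterval (fun t => y t i l) a b) :
    AbsolutelyContinuousOnInterval (fun t => disagreement (y t)) a b := by
  refine finset_sum _ fun l _ => finset_sum _ fun i _ => ?_
  have h1 := (h i l).fun_sub (agentMean fun i => h i l)
  simpa only [sq] using h1.fun_mul h1

/-- Where the average of a component exceeds, in absolute value, the disagreement plus the errors of
the good measurements, all the good measurements push the average back, and they outnumber the
others. Here `c` is the sign of the average. -/
theorem mul_agentMean_le_of_majority [Nonempty V] {s σ y ε : V → o → ℝ} {good : Set V} {l : o}
    {r c : ℝ} (hc : c = 1 ∨ c = -1) (hs : ∀ i, s i l = 0 ∨ s i l = 1)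
    (hmaj : 1 ≤ ∑ i, s i l * open Classical in (if i ∈ good then 1 else -1))
    (hσ : ∀ i, |σ i l| ≤ 1)
    (hgood : ∀ i ∈ good, s i l = 1 → (ε i l < y i l → σ i l = -1) ∧ (y i l < ε i l → σ i l = 1))
    (hr : ∀ i ∈ good, |ε i l| + |y i l - agentMean y l| ≤ r) (hy : r < c * agentMean y l) :
    c * agentMean (fun i l => s i l * σ i l) l ≤ -(1 / Fintype.card V) := by
  have hN : (0 : ℝ) < Fintype.card V := Nat.cast_pos.2 Fintype.card_pos
  have hpt : ∀ i, c * (s i l * σ i l)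
      ≤ -(s i l * open Classical in (if i ∈ good then 1 else -1)) := by
    intro i
    obtain ⟨h1, h2⟩ := abs_le.1 (hσ i)
    rcases hs i with h | h
    · simp [h]
    · rw [h, one_mul, one_mul]
      split_ifs with hi
      · have h3 := hr i hi
        obtain ⟨h4, h5⟩ := hgood i hi h
        have h6 := abs_le.1 (le_refl |ε i l|)
        have h7 := abs_le.1 (le_refl |y i l - agentMean y l|)
        rcases hc with rfl | rfl
        · rw [h4 (by linarith)]; norm_num
        · rw [h5 (by linarith)]; norm_num
      · rcases hc with rfl | rfl <;> linarith
  rw [agentMean, ← mul_div_assoc, ← neg_div, Finset.mul_sum]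
  refine div_le_div_of_nonneg_right ?_ hN.le
  refine (Finset.sum_le_sum fun i _ => hpt i).trans ?_
  rw [Finset.sum_neg_distrib]
  linarith

/-- Agents that follow the signs of the errors to their own measurements and that are strongly
coupled reach every prescribed neighborhood of zero, provided that for every component the
measurements which are bounded and tend to zero outnumber the remaining, arbitrary ones. -/
theorem SimpleGraph.Connected.exists_gains {G : SimpleGraph V} [DecidableRel G.Adj]
    (hG : G.Connected) (M : (o → ℝ) →L[ℝ] (o → ℝ)) {s : V → o → ℝ}
    (hs : ∀ i l, s i l = 0 ∨ s i l = 1) {η D₀ M₀ : ℝ} (hη : 0 < η) (hD₀ : 0 ≤ D₀) (hM₀ : 0 ≤ M₀) :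
    ∃ κs γs : ℝ, 0 ≤ κs ∧ ∀ κ > κs, ∀ γ > γs, ∀ (good : Set V) (y ε : ℝ → V → o → ℝ),
      (∀ l, 1 ≤ ∑ i, s i l * open Classical in (if i ∈ good then 1 else -1)) →
      (∀ i ∈ good, ∀ l t, 0 ≤ t → |ε t i l| ≤ M₀) →
      (∀ i ∈ good, ∀ l, Tendsto (fun t => ε t i l) atTop (𝓝 0)) →
      (∀ i l, |y 0 i l| ≤ D₀) →
      (∀ i l T, 0 ≤ T → AbsolutelyContinuousOnInterval (fun t => y t i l) 0 T) →
      (∀ᵐ t, 0 < t → ∃ σ : V → o → ℝ, (∀ i l, |σ i l| ≤ 1) ∧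
        (∀ i ∈ good, ∀ l, s i l = 1 →
          (ε t i l < y t i l → σ i l = -1) ∧ (y t i l < ε t i l → σ i l = 1)) ∧
        ∀ i l, HasDerivAt (fun t => y t i l)
          (networkField G M κ γ (fun i l => s i l * σ i l) (y t) i l) t) →
      ∀ i l, ∀ᶠ t in atTop, |y t i l| ≤ η := by
  have := hG.nonempty
  have hN : (0 : ℝ) < Fintype.card V := Nat.cast_pos.2 Fintype.card_pos
  set ρ : ℝ := η / 4 with hρ
  have hρ0 : 0 < ρ := by positivity
  obtain ⟨γs, hγs⟩ := hG.exists_disagreement_deriv_le M hρ0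
  set W₀ : ℝ := max (Fintype.card o * (Fintype.card V * (2 * D₀) ^ 2)) (ρ ^ 2) with hW₀
  -- an average above `r₁` exceeds the disagreement plus the good errors, and the averages never
  -- reach `R`
  set r₁ : ℝ := M₀ + √W₀ with hr₁
  have hr₁0 : 0 ≤ r₁ := by positivity
  set R : ℝ := D₀ + r₁ + 1 with hR
  refine ⟨max 1 (Fintype.card V * (‖M‖ * R + 1)), γs, by positivity, ?_⟩
  intro κ hκ γ hγ good y ε hmaj hεb hεlim hy0 hac hode
  obtain ⟨hκ1, hκ2⟩ := max_lt_iff.1 hκ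
  have hκN : ‖M‖ * R - κ * (1 / Fintype.card V) ≤ -1 := by
    rw [mul_one_div]
    have : ‖M‖ * R + 1 < κ / Fintype.card V := by rw [lt_div_iff₀ hN]; linarith
    linarith
  have hτ : ∀ σ : V → o → ℝ, (∀ i l, |σ i l| ≤ 1) → ∀ i l, |s i l * σ i l| ≤ 1 := by
    intro σ hσ i l
    rcases hs i l with h | h <;> simp [h, hσ i l]
  -- the disagreement stays bounded and becomes small
  have hdis : ∀ᵐ t, 0 < t → ρ ^ 2 < disagreement (y t) →
      ∃ d ≤ -ρ ^ 2, HasDerivAt (fun t => disagreement (y t)) d t := by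
    filter_upwards [hode] with t ht h0 hlt
    obtain ⟨σ, hσ, -, hd⟩ := ht h0
    exact ⟨_, hγs κ γ hκ1.le hγ _ (y t) (hτ σ hσ) hlt.le, disagreement_hasDerivAt hd⟩
  have hdisac : ∀ t, 0 ≤ t → AbsolutelyContinuousOnInterval (fun t => disagreement (y t)) 0 t :=
    fun t ht => .disagreement fun i l => hac i l t ht
  have hW : ∀ t, 0 ≤ t → disagreement (y t) ≤ W₀ := fun t ht => by
    have h1 := (hdisac t ht).le_max_of_ae_deriv_le (r := ρ ^ 2) (c := ρ ^ 2) ht (by positivity) (by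
      filter_upwards [hdis] with τ h1 h2
      exact h1 h2.1)
    refine h1.trans (max_le_max ?_ le_rfl)
    have h2 := disagreement_le hy0
    have h3 : 0 ≤ ρ ^ 2 * (t - 0) := by rw [sub_zero]; positivity
    linarith
  have hWev : ∀ᶠ t in atTop, disagreement (y t) ≤ ρ ^ 2 :=
    eventually_le_of_ae_deriv_le (t₀ := 0) (by positivity) hdisac hdis
  -- the averages decrease in absolute value where they are large
  have hmean : ∀ᵐ t, 0 < t → (∀ l, |agentMean (y t) l| ≤ R) → ∀ (l : o) (c : ℝ), c = 1 ∨ c = -1 →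
      ∀ r, (∀ i ∈ good, |ε t i l| + |y t i l - agentMean (y t) l| ≤ r) →
      r < c * agentMean (y t) l → ∃ d ≤ -1, HasDerivAt (fun t => c * agentMean (y t) l) d t := by
    filter_upwards [hode] with t ht h0 hbd l c hc r hr hlt
    obtain ⟨σ, hσ, hgood, hd⟩ := ht h0
    refine ⟨_, ?_, (agentMean_hasDerivAt fun i => hd i l).const_mul c⟩
    rw [agentMean_networkField, mul_add]
    have h1 := mul_agentMean_le_of_majority (ε := ε t) hc (fun i => hs i l) (hmaj l)
      (fun i => hσ i l)
      (fun i hi => hgood i hi l) hr hlt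
    have h2 : c * M (agentMean (y t)) l ≤ ‖M‖ * R := by
      refine (le_abs_self _).trans ?_
      have h3 : |c| = 1 := by rcases hc with rfl | rfl <;> simp
      rw [abs_mul, h3, one_mul]
      refine (norm_le_pi_norm _ l).trans ((M.le_opNorm _).trans ?_)
      gcongr
      exact (pi_norm_le_iff_of_nonneg (by positivity)).2 hbd
    have h4 := mul_le_mul_of_nonneg_left h1 (by linarith : 0 ≤ κ)
    linarith
  -- the averages and their negatives, so that upper bounds for this family bound absolute values
  set g : o × Bool → ℝ → ℝ := fun k t => (if k.2 then 1 else -1) * agentMean (y t) k.1 with hg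
  have hsgn : ∀ b : Bool, ((if b then 1 else -1 : ℝ) = 1 ∨ (if b then 1 else -1 : ℝ) = -1) := by
    intro b; cases b <;> simp
  have hgac : ∀ k t, 0 ≤ t → AbsolutelyContinuousOnInterval (g k) 0 t := fun k t ht =>
    (AbsolutelyContinuousOnInterval.agentMean fun i => hac i k.1 t ht).const_mul _
  have habs : ∀ {t B : ℝ}, (∀ k, g k t ≤ B) → ∀ l, |agentMean (y t) l| ≤ B := fun h l => by
    have h1 := h (l, true)
    have h2 := h (l, false)
    simp only [hg, if_true, Bool.false_eq_true, if_false] at h1 h2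
    exact abs_le.2 ⟨by linarith, by linarith⟩
  have hglt : ∀ t, 0 ≤ t → ∀ k, g k t < R := fun t ht k => by
    refine forall_lt_of_ae_deriv_nonpos (r := r₁) hgac (fun k => ?_) (by linarith) ?_ ht k
    · have h1 : |agentMean (y 0) k.1| ≤ D₀ := abs_agentMean_le fun i => hy0 i k.1
      obtain ⟨h2, h3⟩ := abs_le.1 h1
      rcases hsgn k.2 with h | h <;> simp only [hg, h] <;> linarith
    · filter_upwards [hmean] with τ h1 h2 h3 k h4
      obtain ⟨d, hd, hd'⟩ := h1 h2 (habs h3) k.1 _ (hsgn k.2) r₁ (fun i hi => add_le_add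
        (hεb i hi k.1 τ h2.le) ((abs_sub_agentMean_le _ _ _).trans
          (Real.sqrt_le_sqrt (hW τ h2.le)))) h4
      exact ⟨d, by linarith, hd'⟩
  have hεev : ∀ᶠ t in atTop, ∀ i ∈ good, ∀ l, |ε t i l| ≤ η / 4 := by
    refine eventually_all.2 fun i => ?_
    by_cases hi : i ∈ good
    · refine (eventually_all.2 fun l => ?_).mono fun t ht _ => ht
      have := (hεlim i hi l).abs
      rw [abs_zero] at this
      exact this.eventually_le_const (by positivity)
    · exact Eventually.of_forall fun t h => absurd h hi
  obtain ⟨t₁, ht₁⟩ := eventually_atTop.1 ((hWev.and hεev).and (eventually_ge_atTop 0))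
  have hδ : ∀ t, t₁ ≤ t → ∀ i l, |y t i l - agentMean (y t) l| ≤ η / 4 := fun t ht i l => by
    refine (abs_sub_agentMean_le _ _ _).trans ((Real.sqrt_le_sqrt (ht₁ t ht).1.1).trans ?_)
    rw [Real.sqrt_sq hρ0.le]
  have hgev : ∀ᶠ t in atTop, ∀ k, g k t ≤ η / 2 := by
    refine eventually_all.2 fun k => ?_
    refine eventually_le_of_ae_deriv_le (c := 1) (t₀ := t₁) one_pos (fun t ht => ?_) ?_
    · refine (hgac k t ((ht₁ t ht).2)).mono ?_
      rw [uIcc_of_le ht, uIcc_of_le (ht₁ t ht).2]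
      exact Icc_subset_Icc_left (ht₁ t₁ le_rfl).2
    · filter_upwards [hmean] with τ h1 h2 h3
      have h4 := (ht₁ τ h2.le)
      refine h1 ((ht₁ t₁ le_rfl).2.trans_lt h2) (habs fun k => (hglt τ h4.2 k).le) k.1 _ (hsgn k.2)
        (η / 2) (fun i hi => ?_) h3
      have h5 := h4.1.2 i hi k.1
      have h6 := hδ τ h2.le i k.1
      linarith
  intro i l
  filter_upwards [hgev, eventually_ge_atTop t₁] with t h1 h2
  have h3 := habs h1 l
  have h4 := hδ t h2 i l
  have h5 := abs_add_le (y t i l - agentMean (y t) l) (agentMean (y t) l)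
  rw [sub_add_cancel] at h5
  linarith

end Consensus

/-! ### The structure of the closed loop -/

section ClosedLoop

variable {N n p : ℕ} {m : Fin N → ℕ} (C : (i : Fin N) → Matrix (Fin (m i)) (Fin n) ℝ)
  (A : Matrix (Fin n) (Fin n) ℝ) (B : Matrix (Fin n) (Fin p) ℝ) (G : SimpleGraph (Fin N))
  [DecidableRel G.Adj] (v : Module.Basis (Fin n) ℝ (Fin n → ℝ))
  (L : (i : Fin N) → Matrix (ObsIdx (C i) A v) (Fin (m i)) ℝ) (κ γ : ℝ)

theorem dualVec_dotProduct_sum_smul (c : Fin n → ℝ) (l : Fin n) :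
    dualVec v l ⬝ᵥ ∑ k, c k • v k = c l := by
  rw [dotProduct_sum]
  simp [dualVec_dotProduct_basis, dotProduct_smul]

theorem sum_dualVec_dotProduct_smul (x : Fin n → ℝ) : ∑ l, (dualVec v l ⬝ᵥ x) • v l = x := by
  simp only [dualVec_dotProduct]
  exact v.sum_repr x

/-- The arguments of the signs in the consensus observers. -/
def switching : JointState C A v →ₗ[ℝ] (Fin N × Fin n → ℝ) where
  toFun X j := dualVec v j.2 ⬝ᵥ (obsV (C j.1) A v *ᵥ X.2.1 j.1) - dualVec v j.2 ⬝ᵥ X.2.2 j.1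
  map_add' X Y := by
    funext j
    simp only [Prod.snd_add, Prod.fst_add, Pi.add_apply, Matrix.mulVec_add, dotProduct_add]
    ring
  map_smul' c X := by
    funext j
    simp only [Prod.smul_snd, Prod.smul_fst, Pi.smul_apply, Matrix.mulVec_smul, dotProduct_smul,
      RingHom.id_apply, smul_eq_mul]
    ring

/-- The map through which the signs act on the state. -/
def signInput : (Fin N × Fin n → ℝ) →ₗ[ℝ] JointState C A v where
  toFun σ := (0, 0, fun i => κ • ∑ l, (obsIndicator (C i) A v l * σ (i, l)) • v l)
  map_add' σ τ := by
    simp only [Pi.add_apply, mul_add, add_smul, Finset.sum_add_distrib, smul_add, Prod.mk_add_mk,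
      add_zero]
    rfl
  map_smul' c σ := by
    simp only [Pi.smul_apply, smul_eq_mul, RingHom.id_apply, Prod.smul_mk, smul_zero]
    congr 2
    funext i
    simp only [Pi.smul_apply, Finset.smul_sum, smul_smul]
    exact Finset.sum_congr rfl fun l _ => by ring_nf

/-- The linear part of the closed loop, which includes the coupling of the observers. -/
def closedLoopLinear : JointState C A v →ₗ[ℝ] JointState C A v where
  toFun X := (A *ᵥ X.1,
    fun i => obsW (C i) A v *ᵥ (A *ᵥ (obsV (C i) A v *ᵥ X.2.1 i))
      + L i *ᵥ (C i *ᵥ X.1 - C i *ᵥ (obsV (C i) A v *ᵥ X.2.1 i)),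
    fun i => A *ᵥ X.2.2 i + (κ * γ) • ∑ j ∈ G.neighborFinset i, (X.2.2 j - X.2.2 i))
  map_add' X Y := by
    refine Prod.ext (by simp [Matrix.mulVec_add]) (Prod.ext (funext fun i => ?_) (funext fun i => ?_))
    · simp only [Prod.fst_add, Prod.snd_add, Pi.add_apply, Matrix.mulVec_add, Matrix.mulVec_sub]
      abel
    · simp only [Prod.snd_add, Pi.add_apply, Matrix.mulVec_add, Finset.sum_sub_distrib,
        Finset.sum_add_distrib, smul_sub, smul_add]
      abel
  map_smul' c X := by
    refine Prod.ext (by simp [Matrix.mulVec_smul])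
      (Prod.ext (funext fun i => ?_) (funext fun i => ?_))
    · simp only [Prod.smul_fst, Prod.smul_snd, Pi.smul_apply, Matrix.mulVec_smul, RingHom.id_apply,
        Matrix.mulVec_sub, smul_add, smul_sub]
    · simp only [Prod.smul_snd, Pi.smul_apply, Matrix.mulVec_smul, RingHom.id_apply,
        ← smul_sub, ← Finset.smul_sum, smul_add, smul_comm c]

/-- The map through which the plant input and the attack signals act on the state. -/
def closedLoopInput : ((Fin p → ℝ) × ((i : Fin N) → Fin (m i) → ℝ)) →ₗ[ℝ] JointState C A v where
  toFun w := (B *ᵥ w.1, fun i => obsW (C i) A v *ᵥ (B *ᵥ w.1) + L i *ᵥ w.2 i, fun _ => B *ᵥ w.1)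
  map_add' w w' := by
    refine Prod.ext (by simp [Matrix.mulVec_add])
      (Prod.ext (funext fun i => ?_) (funext fun i => by simp [Matrix.mulVec_add]))
    simp only [Prod.fst_add, Prod.snd_add, Pi.add_apply, Matrix.mulVec_add]
    abel
  map_smul' c w := by
    refine Prod.ext (by simp [Matrix.mulVec_smul])
      (Prod.ext (funext fun i => ?_) (funext fun i => by simp [Matrix.mulVec_smul]))
    simp [Matrix.mulVec_smul]

theorem closedLoopField_eq (u : ℝ → Fin p → ℝ) (a : (i : Fin N) → ℝ → Fin (m i) → ℝ) (t : ℝ)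
    (X : JointState C A v) :
    closedLoopField C A B G v L κ γ u a t X
      = (closedLoopLinear C A G v L κ γ X + closedLoopInput C A B v L (u t, fun i => a i t))
        + signInput C A v κ fun j => Real.sign (switching C A v X j) := by
  refine Prod.ext ?_ (Prod.ext (funext fun i => ?_) (funext fun i => ?_))
  · simp [closedLoopField, closedLoopLinear, closedLoopInput, signInput]
  · simp only [closedLoopField, partialObserverField, closedLoopLinear, closedLoopInput, signInput,
      LinearMap.coe_mk, AddHom.coe_mk, Prod.snd_add, Prod.fst_add, Pi.add_apply, Pi.zero_apply,
      Matrix.mulVec_add, Matrix.mulVec_sub]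
    abel
  · simp only [closedLoopField, consensusObserverField, closedLoopLinear, closedLoopInput,
      signInput, switching, LinearMap.coe_mk, AddHom.coe_mk, Prod.snd_add, Pi.add_apply]
    abel

theorem switching_signInput (σ : Fin N × Fin n → ℝ) (j : Fin N × Fin n) :
    switching C A v (signInput C A v κ σ) j
      = -(κ * obsIndicator (C j.1) A v j.2 * σ j) := by
  simp only [switching, signInput, LinearMap.coe_mk, AddHom.coe_mk, Pi.zero_apply,
    Matrix.mulVec_zero, dotProduct_zero, dotProduct_smul, dualVec_dotProduct_sum_smul, smul_eq_mul]
  ring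

theorem switching_surjective : Function.Surjective (switching C A v) := by
  intro y
  refine ⟨(0, 0, fun i => -∑ l, y (i, l) • v l), funext fun j => ?_⟩
  simp only [switching, LinearMap.coe_mk, AddHom.coe_mk, Pi.zero_apply, Matrix.mulVec_zero,
    dotProduct_zero, dotProduct_neg, dualVec_dotProduct_sum_smul]
  ring

/-- Coordinates of the joint state for which the feedback through the signs is passive: the
coordinates of the plant and of the partial observers, and the arguments of the signs. -/
def passiveCoords :
    JointState C A v →ₗ[ℝ] (Fin n ⊕ (Σ i, ObsIdx (C i) A v) ⊕ (Fin N × Fin n) → ℝ) where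
  toFun X := Sum.elim X.1 (Sum.elim (fun k => X.2.1 k.1 k.2) (switching C A v X))
  map_add' X Y := by
    funext k
    rcases k with k | k | k <;> simp
  map_smul' c X := by
    funext k
    rcases k with k | k | k <;> simp

theorem passiveCoords_injective : Function.Injective (passiveCoords C A v) := by
  refine (injective_iff_map_eq_zero _).2 fun X hX => ?_
  have h1 : X.1 = 0 := funext fun k => congrFun hX (Sum.inl k)
  have h2 : X.2.1 = 0 := funext fun i => funext fun k => congrFun hX (Sum.inr (Sum.inl ⟨i, k⟩))
  have h3 : X.2.2 = 0 := funext fun i => by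
    rw [← sum_dualVec_dotProduct_smul v (X.2.2 i)]
    refine Finset.sum_eq_zero fun l _ => ?_
    have : switching C A v X (i, l) = 0 := congrFun hX (Sum.inr (Sum.inr (i, l)))
    simp only [switching, LinearMap.coe_mk, AddHom.coe_mk, h2, Pi.zero_apply, Matrix.mulVec_zero,
      dotProduct_zero, zero_sub, neg_eq_zero] at this
    rw [this, zero_smul]
  exact Prod.ext h1 (Prod.ext h2 h3)

theorem passiveCoords_dotProduct_signInput (X : JointState C A v) (σ : Fin N × Fin n → ℝ) :
    passiveCoords C A v X ⬝ᵥ passiveCoords C A v (signInput C A v κ σ)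
      = -∑ j, κ * obsIndicator (C j.1) A v j.2 * (switching C A v X j * σ j) := by
  simp only [dotProduct, Fintype.sum_sum_type, passiveCoords, LinearMap.coe_mk, AddHom.coe_mk,
    Sum.elim_inl, Sum.elim_inr, switching_signInput]
  simp only [signInput, LinearMap.coe_mk, AddHom.coe_mk, Pi.zero_apply, mul_zero,
    Finset.sum_const_zero, zero_add, ← Finset.sum_neg_distrib]
  exact Finset.sum_congr rfl fun j _ => by ring

theorem obsIndicator_eq_zero_or_one {o : Type*} (C : Matrix o (Fin n) ℝ) (l : Fin n) :
    obsIndicator C A v l = 0 ∨ obsIndicator C A v l = 1 := by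
  unfold obsIndicator
  split_ifs <;> simp

instance isOpenPosMeasure_jointState :
    (volume : Measure (JointState C A v)).IsOpenPosMeasure := by
  have h1 : (volume : Measure ((i : Fin N) → ObsIdx (C i) A v → ℝ)).IsOpenPosMeasure :=
    Measure.pi.isOpenPosMeasure _
  have h2 : (volume : Measure (Fin N → Fin n → ℝ)).IsOpenPosMeasure :=
    Measure.pi.isOpenPosMeasure _
  exact Measure.prod.instIsOpenPosMeasure

theorem mem_filippovMap_closedLoopField_iff (u : ℝ → Fin p → ℝ)
    (a : (i : Fin N) → ℝ → Fin (m i) → ℝ) (t : ℝ) (X d : JointState C A v) :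
    d ∈ filippovMap (closedLoopField C A B G v L κ γ u a) t X ↔
      ∃ σ ∈ signSet 0 (switching C A v X), d = (closedLoopLinear C A G v L κ γ X
        + closedLoopInput C A B v L (u t, fun i => a i t)) + signInput C A v κ σ :=
  mem_filippovMap_iff
    (g := fun X => closedLoopLinear C A G v L κ γ X
      + closedLoopInput C A B v L (u t, fun i => a i t))
    ((closedLoopLinear C A G v L κ γ).continuous_of_finiteDimensional.add continuous_const)
    (signInput C A v κ).toContinuousLinearMap (switching C A v).toContinuousLinearMap
    (switching_surjective C A v) (closedLoopField_eq C A B G v L κ γ u a t) X d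

theorem locallyIntegrableOn_closedLoopInput {u : ℝ → Fin p → ℝ}
    {a : (i : Fin N) → ℝ → Fin (m i) → ℝ} (hu : LocallyIntegrableOn u (Ici 0))
    (ha : ∀ i, LocallyIntegrableOn (a i) (Ici 0)) :
    LocallyIntegrableOn (fun t => closedLoopInput C A B v L (u t, fun i => a i t)) (Ici 0) := by
  rw [locallyIntegrableOn_iff isClosed_Ici.isLocallyClosed]
  intro k hk hkc
  refine (closedLoopInput C A B v L).toContinuousLinearMap.integrable_comp ?_
  refine (hu.integrableOn_compact_subset hk hkc).prodMk ?_
  exact Integrable.of_eval fun i => (ha i).integrableOn_compact_subset hk hkc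

end ClosedLoop

/-! ### Error coordinates and redundancy -/

section Errors

variable {N n p : ℕ} {m : Fin N → ℕ} (C : (i : Fin N) → Matrix (Fin (m i)) (Fin n) ℝ)
  (A : Matrix (Fin n) (Fin n) ℝ) (B : Matrix (Fin n) (Fin p) ℝ) (G : SimpleGraph (Fin N))
  [DecidableRel G.Adj] (v : Module.Basis (Fin n) ℝ (Fin n → ℝ))
  (L : (i : Fin N) → Matrix (ObsIdx (C i) A v) (Fin (m i)) ℝ) (κ γ : ℝ)

theorem mem_unobservableSubspace_iff {o : Type*} {C : Matrix o (Fin n) ℝ}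
    {A : Matrix (Fin n) (Fin n) ℝ} {x : Fin n → ℝ} :
    x ∈ unobservableSubspace C A ↔ ∀ k : ℕ, (C * A ^ k) *ᵥ x = 0 := by
  simp [unobservableSubspace, Submodule.mem_iInf]

theorem mulVec_mem_unobservableSubspace {o : Type*} {C : Matrix o (Fin n) ℝ}
    {A : Matrix (Fin n) (Fin n) ℝ} {x : Fin n → ℝ} (hx : x ∈ unobservableSubspace C A) :
    A *ᵥ x ∈ unobservableSubspace C A := by
  rw [mem_unobservableSubspace_iff] at hx ⊢
  intro k
  rw [Matrix.mulVec_mulVec, Matrix.mul_assoc, ← pow_succ]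
  exact hx (k + 1)

theorem obsW_mulVec_apply {o : Type*} (C : Matrix o (Fin n) ℝ) (x : Fin n → ℝ)
    (l : ObsIdx C A v) : (obsW C A v *ᵥ x) l = dualVec v l.1 ⬝ᵥ x := rfl

theorem obsV_mulVec {o : Type*} (C : Matrix o (Fin n) ℝ) (z : ObsIdx C A v → ℝ) :
    obsV C A v *ᵥ z = ∑ l, z l • v l.1 := by
  funext j
  simp [obsV, Matrix.mulVec, dotProduct, mul_comm]

theorem dualVec_dotProduct_obsV_mulVec {o : Type*} (C : Matrix o (Fin n) ℝ)
    (z : ObsIdx C A v → ℝ) (l : ObsIdx C A v) : dualVec v l.1 ⬝ᵥ (obsV C A v *ᵥ z) = z l := by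
  classical
  rw [obsV_mulVec, dotProduct_sum]
  simp only [dotProduct_smul, dualVec_dotProduct_basis, smul_eq_mul, mul_ite, mul_one, mul_zero,
    ← Subtype.ext_iff]
  simp

theorem sub_obsV_mulVec_obsW_mem {o : Type*} (C : Matrix o (Fin n) ℝ) (x : Fin n → ℝ) :
    x - obsV C A v *ᵥ (obsW C A v *ᵥ x) ∈ unobservableSubspace C A := by
  classical
  have h1 : obsV C A v *ᵥ (obsW C A v *ᵥ x)
      = ∑ l, if v l ∈ unobservableSubspace C A then 0 else (dualVec v l ⬝ᵥ x) • v l := by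
    rw [obsV_mulVec, Finset.sum_ite, Finset.sum_const_zero, zero_add]
    refine (Finset.sum_subtype (p := fun l => v l ∉ unobservableSubspace C A) _ (by simp)
      fun l => (dualVec v l ⬝ᵥ x) • v l).symm
  rw [h1]
  nth_rewrite 1 [← sum_dualVec_dotProduct_smul v x]
  rw [← Finset.sum_sub_distrib]
  refine Submodule.sum_mem _ fun l _ => ?_
  split_ifs with h
  · rw [sub_zero]; exact Submodule.smul_mem _ _ h
  · rw [sub_self]; exact Submodule.zero_mem _

variable {C A v}

theorem obsW_mulVec_eq_zero (hv : IsCommonBasis C A v) (i : Fin N) {x : Fin n → ℝ}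
    (hx : x ∈ unobservableSubspace (C i) A) : obsW (C i) A v *ᵥ x = 0 := by
  obtain ⟨S, hS⟩ := hv i
  funext l
  rw [obsW_mulVec_apply, dualVec_dotProduct, Pi.zero_apply]
  by_contra hne
  have hl : l.1 ∈ S := (v.mem_span_image.1 (hS.le hx)) (by simpa using hne)
  exact l.2 (hS.ge (Submodule.subset_span (mem_image_of_mem v hl)))

/-- The estimation error of a partial observer, with respect to the observable part of the state. -/
def partialError (C : (i : Fin N) → Matrix (Fin (m i)) (Fin n) ℝ) (A : Matrix (Fin n) (Fin n) ℝ)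
    (v : Module.Basis (Fin n) ℝ (Fin n → ℝ)) (i : Fin N) :
    JointState C A v →ₗ[ℝ] (ObsIdx (C i) A v → ℝ) where
  toFun X := X.2.1 i - obsW (C i) A v *ᵥ X.1
  map_add' X Y := by
    simp only [Prod.snd_add, Prod.fst_add, Pi.add_apply, Matrix.mulVec_add]
    abel
  map_smul' c X := by
    simp only [Prod.smul_snd, Prod.smul_fst, Pi.smul_apply, Matrix.mulVec_smul, RingHom.id_apply,
      smul_sub]

/-- The partial observers reconstruct the observable part of the state up to the attack, because
the unobservable part affects neither that part nor the output. -/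
theorem partialError_closedLoop (hv : IsCommonBasis C A v) (i : Fin N) (X : JointState C A v)
    (w : (Fin p → ℝ) × ((i : Fin N) → Fin (m i) → ℝ)) (σ : Fin N × Fin n → ℝ) :
    partialError C A v i ((closedLoopLinear C A G v L κ γ X + closedLoopInput C A B v L w)
        + signInput C A v κ σ)
      = (obsW (C i) A v * A * obsV (C i) A v - L i * C i * obsV (C i) A v)
          *ᵥ partialError C A v i X + L i *ᵥ w.2 i := by
  have hU := sub_obsV_mulVec_obsW_mem A v (C i) X.1
  have h1 : obsW (C i) A v *ᵥ (A *ᵥ X.1)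
      = obsW (C i) A v *ᵥ (A *ᵥ (obsV (C i) A v *ᵥ (obsW (C i) A v *ᵥ X.1))) := by
    have := obsW_mulVec_eq_zero hv i (mulVec_mem_unobservableSubspace hU)
    rwa [Matrix.mulVec_sub, Matrix.mulVec_sub, sub_eq_zero] at this
  have h2 : C i *ᵥ X.1 = C i *ᵥ (obsV (C i) A v *ᵥ (obsW (C i) A v *ᵥ X.1)) := by
    have := mem_unobservableSubspace_iff.1 hU 0
    rwa [pow_zero, Matrix.mul_one, Matrix.mulVec_sub, sub_eq_zero] at this
  simp only [partialError, closedLoopLinear, closedLoopInput, signInput, LinearMap.coe_mk,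
    AddHom.coe_mk, Prod.fst_add, Prod.snd_add, Pi.add_apply, Pi.zero_apply, add_zero,
    Matrix.mulVec_add, Matrix.mulVec_sub, Matrix.sub_mulVec, ← Matrix.mulVec_mulVec]
  rw [h1, h2]
  abel

/-- The coordinates, with respect to the basis `v`, of the estimation errors of the consensus
observers. -/
def consensusError (C : (i : Fin N) → Matrix (Fin (m i)) (Fin n) ℝ) (A : Matrix (Fin n) (Fin n) ℝ)
    (v : Module.Basis (Fin n) ℝ (Fin n → ℝ)) : JointState C A v →ₗ[ℝ] (Fin N → Fin n → ℝ) where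
  toFun X i l := dualVec v l ⬝ᵥ (X.2.2 i - X.1)
  map_add' X Y := by
    funext i l
    simp only [Prod.snd_add, Prod.fst_add, Pi.add_apply, dotProduct_add, dotProduct_sub]
    ring
  map_smul' c X := by
    funext i l
    simp only [Prod.smul_snd, Prod.smul_fst, Pi.smul_apply, ← smul_sub, dotProduct_smul,
      RingHom.id_apply]

/-- The linear map `A` in the coordinates of the basis `v`. -/
def basisMap (A : Matrix (Fin n) (Fin n) ℝ) (v : Module.Basis (Fin n) ℝ (Fin n → ℝ)) :
    (Fin n → ℝ) →L[ℝ] (Fin n → ℝ) :=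
  LinearMap.toContinuousLinearMap
    (v.equivFun.toLinearMap ∘ₗ Matrix.mulVecLin A ∘ₗ v.equivFun.symm.toLinearMap)

theorem basisMap_dualVec (x : Fin n → ℝ) (l : Fin n) :
    basisMap A v (fun k => dualVec v k ⬝ᵥ x) l = dualVec v l ⬝ᵥ (A *ᵥ x) := by
  simp [basisMap, dualVec_dotProduct]

theorem consensusError_closedLoop (X : JointState C A v)
    (w : (Fin p → ℝ) × ((i : Fin N) → Fin (m i) → ℝ)) (σ : Fin N × Fin n → ℝ) (i : Fin N)
    (l : Fin n) :
    consensusError C A v ((closedLoopLinear C A G v L κ γ X + closedLoopInput C A B v L w)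
        + signInput C A v κ σ) i l
      = networkField G (basisMap A v) κ γ (fun i l => obsIndicator (C i) A v l * σ (i, l))
          (consensusError C A v X) i l := by
  have h1 : basisMap A v (consensusError C A v X i) l
      = dualVec v l ⬝ᵥ (A *ᵥ (X.2.2 i - X.1)) := basisMap_dualVec (X.2.2 i - X.1) l
  have h2 : dualVec v l ⬝ᵥ ∑ j ∈ G.neighborFinset i, (X.2.2 j - X.2.2 i)
      = ∑ j ∈ G.neighborFinset i, (consensusError C A v X j l - consensusError C A v X i l) := by
    rw [dotProduct_sum]
    refine Finset.sum_congr rfl fun j _ => ?_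
    simp only [consensusError, LinearMap.coe_mk, AddHom.coe_mk, dotProduct_sub]
    ring
  rw [networkField, h1, ← h2]
  simp only [consensusError, closedLoopLinear, closedLoopInput, signInput, LinearMap.coe_mk,
    AddHom.coe_mk, Prod.fst_add, Prod.snd_add, Pi.add_apply, add_zero, dotProduct_sub,
    dotProduct_add, dotProduct_smul, dualVec_dotProduct_sum_smul, smul_eq_mul,
    Matrix.mulVec_sub]
  ring

theorem switching_eq_sub (X : JointState C A v) (i : Fin N) (l : ObsIdx (C i) A v) :
    switching C A v X (i, l.1) = partialError C A v i X l - consensusError C A v X i l.1 := by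
  simp only [switching, partialError, consensusError, LinearMap.coe_mk, AddHom.coe_mk,
    dualVec_dotProduct_obsV_mulVec, Pi.sub_apply, obsW_mulVec_apply, dotProduct_sub]
  ring

/-- Every basis vector is observable from at least `2 q + 1` sensor banks. -/
theorem two_mul_lt_card_observing {q : ℕ} (hred : IsRedundantlyObservable C A q) (l : Fin n) :
    2 * q < {i : Fin N | v l ∉ unobservableSubspace (C i) A}.ncard := by
  classical
  by_contra! hcon
  set P : Finset (Fin N) := {i | v l ∉ unobservableSubspace (C i) A} with hP
  have hPc : P.card ≤ 2 * q := by
    rw [← Set.ncard_coe_finset]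
    simpa [hP] using hcon
  have hcard : N - 2 * q ≤ Pᶜ.card := by
    rw [Finset.card_compl, Fintype.card_fin]
    omega
  obtain ⟨S, hSP, hS⟩ := Finset.exists_subset_card_eq hcard
  have hmem : v l ∈ unobservableSubspace (stackedMatrix C S) A := by
    rw [mem_unobservableSubspace_iff]
    intro k
    rw [← Matrix.mulVec_mulVec]
    funext r
    have hr : v l ∈ unobservableSubspace (C r.1) A := by
      have := hSP r.1.2
      simpa [hP] using this
    have h1 := congrFun (mem_unobservableSubspace_iff.1 hr k) r.2
    rw [← Matrix.mulVec_mulVec] at h1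
    exact h1
  rw [hred S hS] at hmem
  exact v.ne_zero l ((Submodule.mem_bot ℝ).1 hmem)

/-- If at most `q` sensor banks are attacked, then for every basis vector, the unattacked sensor
banks from which it is observable outnumber the attacked ones. -/
theorem one_le_sum_obsIndicator {q : ℕ} (hred : IsRedundantlyObservable C A q)
    {good : Set (Fin N)} (hgood : N - q ≤ good.ncard) (l : Fin n) :
    1 ≤ ∑ i, obsIndicator (C i) A v l * open Classical in (if i ∈ good then 1 else -1) := by
  classical
  set T : Finset (Fin N) := {i | i ∈ good} with hT
  set P : Finset (Fin N) := {i | v l ∉ unobservableSubspace (C i) A} with hP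
  have h1 : 2 * q < P.card := by
    have := two_mul_lt_card_observing (v := v) hred l
    rw [← Set.ncard_coe_finset]
    simpa [hP] using this
  have h2 : N - q ≤ T.card := by
    rw [← Set.ncard_coe_finset]
    simpa [hT] using hgood
  have h3 : Tᶜ.card ≤ q := by
    rw [Finset.card_compl, Fintype.card_fin]
    omega
  have h4 : (P \ T).card ≤ Tᶜ.card :=
    Finset.card_le_card fun i hi => by simpa using (Finset.mem_sdiff.1 hi).2
  have h5 : (P ∩ T).card + (P \ T).card = P.card := Finset.card_inter_add_card_sdiff P T
  have h6 : ∀ i, obsIndicator (C i) A v l * (if i ∈ good then 1 else -1)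
      = (if i ∈ P ∩ T then 1 else 0) - (if i ∈ P \ T then 1 else 0) := by
    intro i
    by_cases hi : v l ∈ unobservableSubspace (C i) A <;> by_cases hi' : i ∈ good <;>
      simp [obsIndicator, hP, hT, hi, hi']
  simp only [h6, Finset.sum_sub_distrib, Finset.sum_boole, Finset.filter_mem_eq_inter,
    Finset.univ_inter]
  have h7 : (P \ T).card + 1 ≤ (P ∩ T).card := by omega
  have h8 : ((P \ T).card : ℝ) + 1 ≤ (P ∩ T).card := by exact_mod_cast h7
  linarith

end Errors

/-! ### Solutions of the closed loop -/

section Solutions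

variable {N n p : ℕ} {m : Fin N → ℕ} {C : (i : Fin N) → Matrix (Fin (m i)) (Fin n) ℝ}
  {A : Matrix (Fin n) (Fin n) ℝ} {B : Matrix (Fin n) (Fin p) ℝ} {G : SimpleGraph (Fin N)}
  [DecidableRel G.Adj] {v : Module.Basis (Fin n) ℝ (Fin n → ℝ)}
  {L : (i : Fin N) → Matrix (ObsIdx (C i) A v) (Fin (m i)) ℝ} {κ γ : ℝ}
  {u : ℝ → Fin p → ℝ} {a : (i : Fin N) → ℝ → Fin (m i) → ℝ}

/-- The differential inclusion that a Filippov solution of the closed loop satisfies on an interval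
`I` starting at `0`. -/
theorem IsFilippovSolutionOn.ae_exists_hasDerivAt {X : ℝ → JointState C A v} {I : Set ℝ}
    (hI : MeasurableSet I)
    (hX : IsFilippovSolutionOn (closedLoopField C A B G v L κ γ u a) X I) :
    ∀ᵐ t, t ∈ I → ∃ σ ∈ signSet 0 (switching C A v (X t)), HasDerivAt X
      ((closedLoopLinear C A G v L κ γ (X t) + closedLoopInput C A B v L (u t, fun i => a i t))
        + signInput C A v κ σ) t := by
  filter_upwards [(ae_restrict_iff' hI).1 hX.2] with t ht htI
  obtain ⟨d, hd, hXd⟩ := ht htI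
  obtain ⟨σ, hσ, rfl⟩ := (mem_filippovMap_closedLoopField_iff ..).1 hd
  exact ⟨σ, hσ, hXd⟩

theorem exists_isFilippovSolutionOn_closedLoopField (hκ : 0 ≤ κ)
    (hu : LocallyIntegrableOn u (Ici 0))
    (ha : ∀ i, LocallyIntegrableOn (a i) (Ici 0)) (X₀ : JointState C A v) :
    ∃ X : ℝ → JointState C A v,
      IsFilippovSolutionOn (closedLoopField C A B G v L κ γ u a) X (Ici 0) ∧ X 0 = X₀ := by
  obtain ⟨X, h0, hac, hX⟩ := exists_passive_signSet_solution
    (φ := (passiveCoords C A v).toContinuousLinearMap) (passiveCoords_injective C A v)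
    (closedLoopLinear C A G v L κ γ).toContinuousLinearMap
    (Ψ := (signInput C A v κ).toContinuousLinearMap)
    (h := (switching C A v).toContinuousLinearMap)
    (k := fun j => κ * obsIndicator (C j.1) A v j.2)
    (fun j => mul_nonneg hκ (by rcases obsIndicator_eq_zero_or_one A v (C j.1) j.2 with h | h <;>
      simp [h]))
    (passiveCoords_dotProduct_signInput C A v κ)
    (locallyIntegrableOn_closedLoopInput C A B v L hu ha) X₀
  refine ⟨X, ⟨fun b hb c hc => ?_, ?_⟩, h0⟩
  · refine (hac (max b c) (le_max_of_le_left hb)).mono ?_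
    rw [uIcc_of_le (le_max_of_le_left hb)]
    exact uIcc_subset_Icc ⟨hb, le_max_left b c⟩ ⟨hc, le_max_right b c⟩
  · rw [ae_restrict_iff' measurableSet_Ici]
    filter_upwards [hX, Measure.ae_ne volume 0] with t ht ht0 htI
    obtain ⟨σ, hσ, hXd⟩ := ht (lt_of_le_of_ne htI ht0.symm)
    exact ⟨_, (mem_filippovMap_closedLoopField_iff ..).2 ⟨σ, hσ, rfl⟩, hXd⟩

/-- Filippov solutions of the closed loop are unique. -/
theorem IsFilippovSolutionOn.eqOn_closedLoopField (hκ : 0 ≤ κ) {T : ℝ} {X Y : ℝ → JointState C A v}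
    (hX : IsFilippovSolutionOn (closedLoopField C A B G v L κ γ u a) X (Ici 0))
    (hY : IsFilippovSolutionOn (closedLoopField C A B G v L κ γ u a) Y (Ico 0 T))
    (h0 : X 0 = Y 0) : EqOn X Y (Ico 0 T) := by
  intro t ht
  have hT : 0 < T := ht.1.trans_lt ht.2
  refine eq_of_passive_signSet
    (φ := (passiveCoords C A v).toContinuousLinearMap) (passiveCoords_injective C A v)
    (Λ := (closedLoopLinear C A G v L κ γ).toContinuousLinearMap)
    (Ψ := (signInput C A v κ).toContinuousLinearMap)
    (h := (switching C A v).toContinuousLinearMap)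
    (k := fun j => κ * obsIndicator (C j.1) A v j.2)
    (b := fun t => closedLoopInput C A B v L (u t, fun i => a i t))
    (fun j => mul_nonneg hκ (by rcases obsIndicator_eq_zero_or_one A v (C j.1) j.2 with h | h <;>
      simp [h]))
    (passiveCoords_dotProduct_signInput C A v κ)
    (hX.1 0 self_mem_Ici t ht.1) (hY.1 0 ⟨le_rfl, hT⟩ t ht) ?_ ?_ ht.1 h0
  · filter_upwards [hX.ae_exists_hasDerivAt measurableSet_Ici] with s hs hst
    exact hs hst.1.le
  · filter_upwards [hY.ae_exists_hasDerivAt measurableSet_Ico] with s hs hst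
    exact hs ⟨hst.1.le, hst.2.trans ht.2⟩

end Solutions

theorem theorem2 {N n p : ℕ} {m : Fin N → ℕ} (q : ℕ)
    (A : Matrix (Fin n) (Fin n) ℝ) (B : Matrix (Fin n) (Fin p) ℝ)
    (C : (i : Fin N) → Matrix (Fin (m i)) (Fin n) ℝ)
    (hred : IsRedundantlyObservable C A q)
    (G : SimpleGraph (Fin N)) [DecidableRel G.Adj] (hG : G.Connected)
    (v : Module.Basis (Fin n) ℝ (Fin n → ℝ)) (hv : IsCommonBasis C A v)
    (L : (i : Fin N) → Matrix (ObsIdx (C i) A v) (Fin (m i)) ℝ)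
    (hL : ∀ i, IsHurwitz (obsW (C i) A v * A * obsV (C i) A v - L i * C i * obsV (C i) A v))
    (K : Set (JointState C A v)) (hK : IsCompact K) (η : ℝ) (hη : 0 < η) :
    ∃ κs γs : ℝ, ∀ κ > κs, ∀ γ > γs,
      ∀ (u : ℝ → Fin p → ℝ) (a : (i : Fin N) → ℝ → Fin (m i) → ℝ),
        LocallyIntegrableOn u (Ici 0) →
        (∀ i, LocallyIntegrableOn (a i) (Ici 0)) →
        AttacksAtMost a q →
        ∀ X₀ ∈ K,
          -- a solution exists for all `t ≥ 0`
          (∃ X : ℝ → JointState C A v,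
            IsFilippovSolutionOn (closedLoopField C A B G v L κ γ u a) X (Ici 0) ∧ X 0 = X₀) ∧
          -- no solution ceases to exist in finite time
          (∀ T > 0, ∀ Y : ℝ → JointState C A v,
            IsFilippovSolutionOn (closedLoopField C A B G v L κ γ u a) Y (Ico 0 T) → Y 0 = X₀ →
            ∃ X : ℝ → JointState C A v,
              IsFilippovSolutionOn (closedLoopField C A B G v L κ γ u a) X (Ici 0) ∧
                EqOn X Y (Ico 0 T)) ∧
          -- every solution satisfies the error bound, in the maximum norm of `ℝⁿ`
          (∀ X : ℝ → JointState C A v,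
            IsFilippovSolutionOn (closedLoopField C A B G v L κ γ u a) X (Ici 0) → X 0 = X₀ →
            ∀ i : Fin N,
              limsup (fun t : ℝ => ((‖(X t).2.2 i - (X t).1‖ : ℝ) : EReal)) atTop ≤ (η : EReal)) := by
  choose c hc0 hc using fun i => (hL i).exists_bound
  obtain ⟨K₀, hK₀⟩ := hK.exists_bound_of_continuousOn continuousOn_id
  set cE := (consensusError C A v).toContinuousLinearMap with hcE
  set pE := fun i => (partialError C A v i).toContinuousLinearMap with hpE
  set k := max K₀ 0 with hk
  have hk0 : 0 ≤ k := le_max_right _ _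
  have hKk : ∀ X ∈ K, ‖X‖ ≤ k := fun X hX => (hK₀ X hX).trans (le_max_left _ _)
  -- coordinates of size `η / S` give a vector of norm at most `η`
  set S := ∑ l, ‖v l‖ + 1 with hS
  have hS0 : 0 < S := by positivity
  have hM0 : ∀ i, 0 ≤ c i * (‖pE i‖ * k) := fun i =>
    mul_nonneg (hc0 i) (mul_nonneg (norm_nonneg _) hk0)
  obtain ⟨κs, γs, hκs, hgain⟩ := hG.exists_gains (basisMap A v)
    (s := fun i l => obsIndicator (C i) A v l)
    (fun i l => obsIndicator_eq_zero_or_one A v (C i) l) (div_pos hη hS0)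
    (D₀ := ‖cE‖ * k) (M₀ := ∑ i, c i * (‖pE i‖ * k))
    (mul_nonneg (norm_nonneg _) hk0) (Finset.sum_nonneg fun i _ => hM0 i)
  refine ⟨κs, γs, fun κ hκ γ hγ u a hu ha hatt X₀ hX₀ => ?_⟩
  have hκ0 : 0 ≤ κ := hκs.trans hκ.le
  refine ⟨exists_isFilippovSolutionOn_closedLoopField hκ0 hu ha X₀, fun T _ Y hY hY0 => ?_,
    fun X hX hX0 i => ?_⟩
  · obtain ⟨X, hX, hX0⟩ := exists_isFilippovSolutionOn_closedLoopField (B := B) (G := G) (L := L)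
      (γ := γ) hκ0 hu ha X₀
    exact ⟨X, hX, hX.eqOn_closedLoopField hκ0 hY (hX0.trans hY0.symm)⟩
  · have hode := hX.ae_exists_hasDerivAt measurableSet_Ici
    have hac : ∀ T, 0 ≤ T → AbsolutelyContinuousOnInterval X 0 T := fun T hT =>
      hX.1 0 self_mem_Ici T hT
    have hXk : ‖X 0‖ ≤ k := hX0 ▸ hKk X₀ hX₀
    set good : Set (Fin N) := {i | ∀ t : ℝ, 0 ≤ t → a i t = 0} with hgood
    have hpart : ∀ i ∈ good, (∀ t, 0 ≤ t → ‖pE i (X t)‖ ≤ c i * ‖pE i (X 0)‖) ∧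
        Tendsto (fun t => pE i (X t)) atTop (𝓝 0) := by
      intro i hi
      refine hc i (fun t => pE i (X t)) (fun T hT => (hac T hT).clm_comp (pE i)) ?_
      filter_upwards [hode] with t ht ht0
      obtain ⟨σ, -, hXd⟩ := ht ht0.le
      have h1 := (pE i).hasFDerivAt.comp_hasDerivAt t hXd
      have h2 := partialError_closedLoop (B := B) (G := G) (L := L) (κ := κ) (γ := γ) hv i (X t)
        (u t, fun i => a i t) σ
      simp only [hi t ht0.le, Matrix.mulVec_zero, add_zero] at h2
      exact h2 ▸ h1
    -- the errors of the partial observers, extended by zero to the unobservable basis vectors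
    set ε : ℝ → Fin N → Fin n → ℝ := fun t i l =>
      open Classical in
      if h : v l ∉ unobservableSubspace (C i) A then partialError C A v i (X t) ⟨l, h⟩ else 0
      with hε
    have hεle : ∀ t i l, |ε t i l| ≤ ‖pE i (X t)‖ := by
      intro t i l
      simp only [hε]
      split_ifs with h
      · rw [abs_zero]; exact norm_nonneg _
      · exact norm_le_pi_norm (pE i (X t)) ⟨l, h⟩
    have hinit : ∀ i l, |consensusError C A v (X 0) i l| ≤ ‖cE‖ * k := fun i l =>
      ((norm_le_pi_norm (cE (X 0) i) l).trans (norm_le_pi_norm (cE (X 0)) i)).trans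
        (cE.le_opNorm_of_le hXk)
    set eE : Fin N → Fin n → JointState C A v →L[ℝ] ℝ := fun i l =>
      (LinearMap.proj l ∘ₗ LinearMap.proj i ∘ₗ consensusError C A v).toContinuousLinearMap
    have hbound := hgain κ hκ γ hγ good (fun t => consensusError C A v (X t)) ε
      (fun l => one_le_sum_obsIndicator hred hatt l)
      (fun i hi l t ht => by
        refine (hεle t i l).trans (((hpart i hi).1 t ht).trans ?_)
        refine le_trans ?_ (Finset.single_le_sum (fun i _ => hM0 i) (Finset.mem_univ i))
        exact mul_le_mul_of_nonneg_left ((pE i).le_opNorm_of_le hXk) (hc0 i))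
      (fun i hi l => squeeze_zero_norm (fun t => hεle t i l)
        (tendsto_zero_iff_norm_tendsto_zero.1 (hpart i hi).2))
      hinit (fun i l T hT => (hac T hT).clm_comp (eE i l))
      (by
        filter_upwards [hode] with t ht ht0
        obtain ⟨σ, hσ, hXd⟩ := ht ht0.le
        refine ⟨fun i l => σ (i, l), fun i l => (hσ (i, l)).1, fun i _ l hs => ?_, fun i l => ?_⟩
        · have hl : v l ∉ unobservableSubspace (C i) A := fun h => by
            simp [obsIndicator, h] at hs
          have hsw := switching_eq_sub (X t) i ⟨l, hl⟩
          have hεt : ε t i l = partialError C A v i (X t) ⟨l, hl⟩ := dif_pos hl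
          rw [← hεt] at hsw
          exact ⟨fun h => eq_neg_one_of_mem_signSet hσ (by rw [hsw]; exact sub_neg.2 h),
            fun h => eq_one_of_mem_signSet hσ (by rw [hsw]; exact sub_pos.2 h)⟩
        · rw [← consensusError_closedLoop B G L κ γ (X t)
            (u t, fun i => a i t)]
          exact (eE i l).hasFDerivAt.comp_hasDerivAt t hXd)
    refine limsup_le_of_le (by isBoundedDefault) ?_
    filter_upwards [eventually_all.2 fun l => hbound i l] with t ht
    rw [EReal.coe_le_coe_iff, ← sum_dualVec_dotProduct_smul v ((X t).2.2 i - (X t).1)]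
    calc ‖∑ l, (dualVec v l ⬝ᵥ ((X t).2.2 i - (X t).1)) • v l‖
        ≤ ∑ l, η / S * ‖v l‖ := by
          refine norm_sum_le_of_le _ fun l _ => ?_
          rw [norm_smul]
          exact mul_le_mul_of_nonneg_right (ht l) (norm_nonneg _)
      _ = η * ((∑ l, ‖v l‖) / S) := by rw [← Finset.mul_sum]; ring
      _ ≤ η * 1 := by
          gcongr
          rw [div_le_one hS0, hS]
          linarith
      _ = η := mul_one η

end
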